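/- Let $C\subset\mathbb R^2$ be the closed disc with center $(a,b)\in\mathbb R^2$ and radius $r>0$, let $C_i=\{iX : X\in C\}$ for $i\in\mathbb N$ (with $0\in\mathbb N$), and let $\mathcal S=\bigcup_{i\ge 0} C_i\cap\mathbb N^2$, which is a submonoid of $\mathbb N^2$. Let $L=\{\sum_{j} q_ja_j : q_j\in\mathbb Q_{\ge 0},\ a_j\in C\cap\mathbb R^2_{\ge}\}$ (finite sums) be the cone generated by $C\cap\mathbb R^2_{\ge}$, and let $\mathcal C=L\cap\mathbb N^2$. A line $\tau$ through the origin is called an extremal ray of $L$ if $L\cap\tau\neq\{0\}$ and if $X,Y\in L$, $X+Y\in\tau$ imply $X,Y\in\tau$. (1) If $C\cap\mathbb R^2_{\ge}=\emptyset$, then $\mathcal S=\{0\}$. (2) Suppose that $L$ has two extremal rays $\tau_1,\tau_2$, the slope of $\tau_1$ being greater than the slope of $\tau_2$ (a vertical line has slope $\infty$). Then $\mathcal S$ is finitely generated if and only if both $C\cap\tau_1$ and $C\cap\tau_2$ contain a point with rational coordinates. In such case $\mathcal S\subseteq\mathcal C$, and only finitely many points of $\mathcal C\setminus(\tau_1\cup\tau_2)$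 do not belong to $\mathcal S$; that is, $\mathcal S$ is obtained from $\mathcal C$ by removing finitely many interior points and some points of the extremal rays. (3) The minimal system of generators of $\mathcal S$ can be computed algorithmically. There is one algorithm which, for all real $a,b$ and $r>0$ such that $C\cap\mathbb R^2_{\ge}=\emptyset$ or $L$ has two extremal rays as in (2), and such that $\mathcal S$ is finitely generated, halts on the input $(a,b,r)$ and outputs a finite list of the elements of the minimal system of generators of $\mathcal S$, i.e. of a set that generates $\mathcal S$ and has no proper subset generating $\mathcal S$. Here an algorithm on real input is a computable (Turing) procedure which has access to the input through exact comparisons: it may ask, adaptively, whether $p(a,b,r)\ge 0$ for polynomials $p$ with integer coefficients (computation over the reals in the sense of Blum, Shub and Smale, without real constants). -/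

import Mathlib

noncomputable section

/-- The Euclidean plane. -/
abbrev Plane : Type := EuclideanSpace ℝ (Fin 2)

/-- The closed quadrant of points with non-negative coordinates. -/
def quadrant : Set Plane := {X | 0 ≤ X 0 ∧ 0 ≤ X 1}

/-- A lattice point of `ℕ²` seen in the plane. -/
def latticePoint (n : ℕ × ℕ) : Plane := !₂[(n.1 : ℝ), (n.2 : ℝ)]

lemma latticePoint_zero : latticePoint 0 = 0 := by
  ext i; fin_cases i <;> simp [latticePoint]

lemma latticePoint_add (m n : ℕ × ℕ) :
    latticePoint (m + n) = latticePoint m + latticePoint n := by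
  ext i; fin_cases i <;> simp [latticePoint]

/-- The closed disc with center `(a, b)` and radius `r`. -/
def disc (a b r : ℝ) : Set Plane := Metric.closedBall !₂[a, b] r

/-- The semigroup `⋃ i, (i • C) ∩ ℕ²` generated by the disc `C` with center `(a, b)` and
radius `r`. -/
def discSemigroup (a b r : ℝ) (hr : 0 < r) : AddSubmonoid (ℕ × ℕ) where
  carrier := {n | ∃ i : ℕ, ∃ X ∈ disc a b r, latticePoint n = (i : ℝ) • X}
  zero_mem' := ⟨0, !₂[a, b], Metric.mem_closedBall_self hr.le, by simp [latticePoint_zero]⟩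
  add_mem' := by
    rintro m n ⟨i, X, hX, hm⟩ ⟨j, Y, hY, hn⟩
    rcases Nat.eq_zero_or_pos (i + j) with h | h
    · obtain ⟨rfl, rfl⟩ : i = 0 ∧ j = 0 := by omega
      exact ⟨0, X, hX, by rw [latticePoint_add, hm, hn]; simp⟩
    · have h' : (0 : ℝ) < (i : ℝ) + j := by exact_mod_cast h
      refine ⟨i + j, ((i : ℝ) / (i + j)) • X + ((j : ℝ) / (i + j)) • Y,
        (convex_closedBall _ _) hX hY (by positivity) (by positivity) (by field_simp), ?_⟩
      rw [latticePoint_add, hm, hn, smul_add, smul_smul, smul_smul]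
      push_cast
      rw [mul_div_cancel₀ _ h'.ne', mul_div_cancel₀ _ h'.ne']

/-- The cone `{∑ qᵢ aᵢ | qᵢ ∈ ℚ, qᵢ ≥ 0, aᵢ ∈ A}` (finite sums) generated by `A`. -/
def rationalCone (A : Set Plane) : Submodule ℚ≥0 Plane := Submodule.span ℚ≥0 A

/-- The integer cone `L(C ∩ ℝ²≥) ∩ ℕ²` of the disc `C` with center `(a, b)` and radius `r`. -/
def integerCone (a b r : ℝ) : Set (ℕ × ℕ) :=
  {n | latticePoint n ∈ rationalCone (disc a b r ∩ quadrant)}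

/-- `τ` is an extremal ray of the cone `L`: a line through the origin which meets `L` outside the
origin and such that a sum of two elements of `L` lies on `τ` only if both summands do. (As usual
for cones in the quadrant, a ray is identified with the line that it spans.) -/
def IsExtremalRay (L : Submodule ℚ≥0 Plane) (τ : Submodule ℝ Plane) : Prop :=
  Module.finrank ℝ τ = 1 ∧ (∃ X ∈ L, X ∈ τ ∧ X ≠ 0) ∧
    ∀ X ∈ L, ∀ Y ∈ L, X + Y ∈ τ → X ∈ τ ∧ Y ∈ τ

/-- The slope of `τ₁` is greater than the slope of `τ₂`, for lines of slope in `[0, ∞]`. The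
slopes `u 1 / u 0` and `v 1 / v 0` are compared by cross-multiplication, so that a vertical line has
slope `∞`. -/
def SlopeGreater (τ₁ τ₂ : Submodule ℝ Plane) : Prop :=
  ∃ u ∈ τ₁, ∃ v ∈ τ₂, u ∈ quadrant ∧ v ∈ quadrant ∧ v 1 * u 0 < u 1 * v 0

/-- `τ₁` and `τ₂` are the extremal rays of `L(C ∩ ℝ²≥)`, that of greater slope being `τ₁`. -/
def AreExtremalRays (a b r : ℝ) (τ₁ τ₂ : Submodule ℝ Plane) : Prop :=
  IsExtremalRay (rationalCone (disc a b r ∩ quadrant)) τ₁ ∧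
  IsExtremalRay (rationalCone (disc a b r ∩ quadrant)) τ₂ ∧ SlopeGreater τ₁ τ₂

/-- The set `A` contains a point with rational coordinates. -/
def HasRationalPoint (A : Set Plane) : Prop :=
  ∃ p q : ℚ, (!₂[(p : ℝ), (q : ℝ)] : Plane) ∈ A

/-- `B` generates `S` and no proper subset of `B` does. -/
def IsMinimalGeneratingSystem (B : Set (ℕ × ℕ)) (S : AddSubmonoid (ℕ × ℕ)) : Prop :=
  AddSubmonoid.closure B = S ∧ ∀ B' : Set (ℕ × ℕ), B' ⊂ B → AddSubmonoid.closure B' ≠ S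

/-! ### Algorithms on discs with real parameters

An algorithm is a computable interactive procedure. The parameters `(a, b, r)` are accessible
through exact comparisons only: the procedure may ask whether `p(a, b, r) ≥ 0`, where `p` is a
polynomial with integer coefficients. This is computation over the reals in the sense of Blum, Shub
and Smale, without real constants: branchings there are decided by the signs of rational functions
of the input with rational coefficients, that is, by signs of integer polynomials. -/

/-- A polynomial in three variables with integer coefficients, as a list of monomials:
`(c, i, j, k)` stands for `c * x ^ i * y ^ j * z ^ k`. -/
abbrev IntPoly : Type := List (ℤ × ℕ × ℕ × ℕ)

/-- The value of an integer polynomial at `(a, b, r)`. -/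
def IntPoly.value (p : IntPoly) (a b r : ℝ) : ℝ :=
  (p.map fun m => (m.1 : ℝ) * a ^ m.2.1 * b ^ m.2.2.1 * r ^ m.2.2.2).sum

/-- The answer to the question whether `p(a, b, r) ≥ 0`. -/
def IntPoly.answer (p : IntPoly) (a b r : ℝ) : Bool := decide (0 ≤ p.value a b r)

/-- The control of an interactive procedure: from the answers received so far (the latest one
first) it determines either the next question or the final output, a finite list of lattice
points. -/
abbrev Procedure : Type := List Bool → IntPoly ⊕ List (ℕ × ℕ)

/-- The lists of answers that the procedure receives in its run on the input `(a, b, r)`. -/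
inductive Procedure.Reaches (M : Procedure) (a b r : ℝ) : List Bool → Prop
  | start : Procedure.Reaches M a b r []
  | ask (h : List Bool) (p : IntPoly) : Procedure.Reaches M a b r h → M h = Sum.inl p →
      Procedure.Reaches M a b r (p.answer a b r :: h)

/-- On the input `(a, b, r)` the procedure halts with output `l`. -/
def Procedure.Outputs (M : Procedure) (a b r : ℝ) (l : List (ℕ × ℕ)) : Prop :=
  ∃ h : List Bool, M.Reaches a b r h ∧ M h = Sum.inr l

end

/-! Let F(x, y, i) = i²r² - |(x, y) - i(a, b)|² and k = a² + b² - r². A lattice point is in the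
semigroup iff F ≥ 0 at some natural height i. For fixed (x, y), F is a polynomial in i with
quadratic term -k i², so a real height with F ≥ |k| can be rounded to a natural one
(`exists_nat_discForm_nonneg`). The polar form is positive on two vectors of the cone over different
directions (`discPolar_pos`). Hence, if both boundary rays carry lattice vectors of the semigroup,
every lattice point whose two coordinates along these vectors have a large product is in the
semigroup. This leaves finitely many gaps off the rays (`IsFrame.finite_gaps`); moreover, from each
element outside a box a boundary vector can be subtracted within the semigroup
(`IsFrame.exists_sub`), so the box contains generators.

A rational point on a boundary ray yields such a vector: either the ray is tangent and the contact
point is rational, or the ray is a coordinate axis crossing the interior of the disc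
(`IsRayPair.exists_endCondition`). Conversely, if a boundary ray carries no nonzero element,
finitely many generators span a cone that stays away from it, while rational points of the disc
close to the ray give elements outside that cone (`IsRayPair.exists_mem_left`).

For the algorithm, a frame, the generation of its box and the irreducibility of the generators are
witnessed by finitely many polynomial signs. Non-membership is too: if k > 0 only boundedly many
heights matter, and if k ≤ 0 everything is in the semigroup (`IsRayPair.mem_of_nonpos`). The
procedure asks all questions in turn and searches for a certificate;
`IsCert.isMinimalGeneratingSystem` is its soundness, `exists_isCert` its completeness. -/

/-! ### The quadratic form of the cone over the disc -/

/-- The quadratic form of the cone over the disc with center `(a, b)` and radius `r`: it is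
non-negative at `(x, y, i)` if and only if `(x, y)` lies in the `i`-th dilate of the disc. -/
def discForm (a b r x y i : ℝ) : ℝ := i ^ 2 * r ^ 2 - (x - i * a) ^ 2 - (y - i * b) ^ 2

/-- The polar form of `discForm`. -/
def discPolar (a b r x y i x' y' i' : ℝ) : ℝ :=
  i * i' * r ^ 2 - (x - i * a) * (x' - i' * a) - (y - i * b) * (y' - i' * b)

lemma discForm_swap (a b r x y i : ℝ) : discForm b a r y x i = discForm a b r x y i := by
  unfold discForm; ring

lemma discForm_smul (a b r x y i s : ℝ) :
    discForm a b r (s * x) (s * y) (s * i) = s ^ 2 * discForm a b r x y i := by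
  unfold discForm; ring

lemma discForm_comb (a b r x y i x' y' i' s t : ℝ) :
    discForm a b r (s * x + t * x') (s * y + t * y') (s * i + t * i') =
      s ^ 2 * discForm a b r x y i + t ^ 2 * discForm a b r x' y' i' +
        2 * s * t * discPolar a b r x y i x' y' i' := by
  unfold discForm discPolar; ring

lemma discForm_expand (a b r x y i : ℝ) :
    discForm a b r x y i =
      i * (2 * (x * a + y * b) - (a ^ 2 + b ^ 2 - r ^ 2) * i) - (x ^ 2 + y ^ 2) := by
  unfold discForm; ring

/-- Moving from `t` to the neighbouring integer on the side where the linear term does not decrease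
costs at most the quadratic term, which is bounded by `|a ^ 2 + b ^ 2 - r ^ 2|`. -/
lemma exists_nat_discForm_nonneg {a b r x y t : ℝ} (ht : 0 ≤ t)
    (h : |a ^ 2 + b ^ 2 - r ^ 2| ≤ discForm a b r x y t) : ∃ i : ℕ, 0 ≤ discForm a b r x y i := by
  obtain ⟨h1, h2⟩ := abs_le.1 h
  have key : ∀ e : ℝ, discForm a b r x y (t + e) = discForm a b r x y t +
      2 * e * (x * a + y * b - (a ^ 2 + b ^ 2 - r ^ 2) * t) - e ^ 2 * (a ^ 2 + b ^ 2 - r ^ 2) := by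
    intro e; unfold discForm; ring
  have main : ∀ i : ℕ, ((i : ℝ) - t) ^ 2 ≤ 1 →
      0 ≤ ((i : ℝ) - t) * (x * a + y * b - (a ^ 2 + b ^ 2 - r ^ 2) * t) →
      0 ≤ discForm a b r x y i := by
    intro i hi hg
    have h3 := key (i - t)
    rw [add_sub_cancel] at h3
    have h4 : ((i : ℝ) - t) ^ 2 * (a ^ 2 + b ^ 2 - r ^ 2) ≤ |a ^ 2 + b ^ 2 - r ^ 2| := by
      calc ((i : ℝ) - t) ^ 2 * (a ^ 2 + b ^ 2 - r ^ 2)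
          ≤ ((i : ℝ) - t) ^ 2 * |a ^ 2 + b ^ 2 - r ^ 2| := by gcongr; exact le_abs_self _
        _ ≤ 1 * |a ^ 2 + b ^ 2 - r ^ 2| := by gcongr
        _ = _ := one_mul _
    linarith
  rcases le_total 0 (x * a + y * b - (a ^ 2 + b ^ 2 - r ^ 2) * t) with hg | hg
  · refine ⟨⌈t⌉₊, main _ ?_ ?_⟩
    · have h3 := Nat.le_ceil t
      have h4 := Nat.ceil_lt_add_one ht
      nlinarith
    · exact mul_nonneg (sub_nonneg.2 (Nat.le_ceil t)) hg
  · refine ⟨⌊t⌋₊, main _ ?_ ?_⟩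
    · have h3 := Nat.floor_le ht
      have h4 := Nat.lt_floor_add_one t
      nlinarith
    · exact mul_nonneg_of_nonpos_of_nonpos (sub_nonpos.2 (Nat.floor_le ht)) hg

/-- A reversed Cauchy–Schwarz inequality: up to a positive factor the polar form is a combination of
the two values plus the squared distance of `(x, y) / i` and `(x', y') / i'`, which are distinct
points. -/
lemma discPolar_pos {a b r x y i x' y' i' : ℝ} (hi : 0 < i) (hi' : 0 < i')
    (h : 0 ≤ discForm a b r x y i) (h' : 0 ≤ discForm a b r x' y' i') (hne : x * y' ≠ y * x') :
    0 < discPolar a b r x y i x' y' i' := by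
  have h1 : 0 < (i' * x - i * x') ^ 2 + (i' * y - i * y') ^ 2 := by
    by_contra hcon
    have e1 : i' * x - i * x' = 0 := by nlinarith
    have e2 : i' * y - i * y' = 0 := by nlinarith
    apply hne
    have : i' * (x * y' - y * x') = 0 := by linear_combination y' * e1 - x' * e2
    rcases mul_eq_zero.1 this with h0 | h0
    · exact absurd h0 hi'.ne'
    · linarith
  have h2 : 2 * (i * i') * discPolar a b r x y i x' y' i' = i' ^ 2 * discForm a b r x y i +
      i ^ 2 * discForm a b r x' y' i' + ((i' * x - i * x') ^ 2 + (i' * y - i * y') ^ 2) := by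
    unfold discForm discPolar; ring
  have h3 : 0 < 2 * (i * i') * discPolar a b r x y i x' y' i' := by rw [h2]; positivity
  exact pos_of_mul_pos_right h3 (by positivity)

lemma pos_of_discForm_nonneg {a b r x y i : ℝ} (h : 0 ≤ discForm a b r x y i) (hi : 0 ≤ i)
    (hne : x ≠ 0 ∨ y ≠ 0) : 0 < i := by
  rcases hi.eq_or_lt with rfl | h0
  · exfalso
    unfold discForm at h
    rcases hne with h1 | h1 <;> have := sq_pos_of_ne_zero h1 <;> nlinarith [sq_nonneg x, sq_nonneg y]
  · exact h0

/-! ### Lattice vectors on a boundary ray -/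

/-- The lattice vector `(p, q)` either spans a line that bounds the disc from the left, or it lies on
the vertical axis, well inside of the cone over the disc. -/
def EndCondition (a b r : ℝ) (p q i N : ℕ) : Prop :=
  (0 ≤ q * a - p * b ∧ r ^ 2 * ((p : ℝ) ^ 2 + q ^ 2) ≤ (q * a - p * b) ^ 2) ∨
    (p = 0 ∧ |a ^ 2 + b ^ 2 - r ^ 2| ≤ N * discForm a b r p q i)

/-- By Cauchy–Schwarz, the offset `(u, v)` from the center of the dilate changes the linear form by
at most `i` times its value at `(a, b)`. -/
lemma nonneg_of_support {a b r p q x y i : ℝ} (hi : 0 ≤ i) (h0 : 0 ≤ q * a - p * b)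
    (h1 : r ^ 2 * (p ^ 2 + q ^ 2) ≤ (q * a - p * b) ^ 2) (h : 0 ≤ discForm a b r x y i) :
    0 ≤ q * x - p * y := by
  set u := x - i * a with hu
  set v := y - i * b with hv
  have e : q * x - p * y = i * (q * a - p * b) + (q * u - p * v) := by rw [hu, hv]; ring
  have h2 : (q * u - p * v) ^ 2 ≤ (i * (q * a - p * b)) ^ 2 := by
    have : u ^ 2 + v ^ 2 ≤ i ^ 2 * r ^ 2 := by unfold discForm at h; linarith
    calc (q * u - p * v) ^ 2 ≤ (u ^ 2 + v ^ 2) * (p ^ 2 + q ^ 2) := by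
          nlinarith [sq_nonneg (p * u + q * v)]
      _ ≤ i ^ 2 * r ^ 2 * (p ^ 2 + q ^ 2) := by gcongr
      _ = i ^ 2 * (r ^ 2 * (p ^ 2 + q ^ 2)) := by ring
      _ ≤ i ^ 2 * (q * a - p * b) ^ 2 := by gcongr
      _ = _ := by ring
  have h3 := (abs_le.1 (abs_le_of_sq_le_sq h2 (by positivity))).1
  rw [e]; linarith

lemma EndCondition.nonneg {a b r : ℝ} {p q i N : ℕ} (h : EndCondition a b r p q i N) {x y j : ℝ}
    (hx : 0 ≤ x) (hj : 0 ≤ j) (hF : 0 ≤ discForm a b r x y j) : 0 ≤ q * x - p * y := by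
  rcases h with ⟨h0, h1⟩ | ⟨rfl, -⟩
  · exact nonneg_of_support hj h0 h1 hF
  · simp; positivity

/-- A supporting line of the disc meets the disc in one point only. -/
lemma eq_of_support {a b r p q i s j : ℝ} (hne : 0 < p ^ 2 + q ^ 2)
    (h1 : r ^ 2 * (p ^ 2 + q ^ 2) ≤ (q * a - p * b) ^ 2) (h : 0 ≤ discForm a b r p q i)
    (h' : 0 ≤ discForm a b r (s * p) (s * q) j) : j = s * i := by
  have key : ∀ s j : ℝ, 0 ≤ discForm a b r (s * p) (s * q) j →
      s * (p ^ 2 + q ^ 2) = j * (a * p + b * q) := by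
    intro s j h
    have h2 : j ^ 2 * (r ^ 2 * (p ^ 2 + q ^ 2)) ≤ j ^ 2 * (q * a - p * b) ^ 2 := by gcongr
    -- By `h1` the right-hand side is a non-positive number minus a square, so the square vanishes.
    have h3 : (p ^ 2 + q ^ 2) * discForm a b r (s * p) (s * q) j =
        j ^ 2 * (r ^ 2 * (p ^ 2 + q ^ 2)) - j ^ 2 * (q * a - p * b) ^ 2 -
          (s * (p ^ 2 + q ^ 2) - j * (a * p + b * q)) ^ 2 := by unfold discForm; ring
    have h4 : 0 ≤ (p ^ 2 + q ^ 2) * discForm a b r (s * p) (s * q) j := by positivity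
    nlinarith
  have e1 := key 1 i (by simpa using h)
  have e2 := key s j h'
  have e3 : a * p + b * q ≠ 0 := by
    intro h0; rw [h0] at e1; linarith
  apply mul_right_cancel₀ e3
  linear_combination s * e1 - e2

/-- On a tangent ray heights are proportional to the points, so `i` can be subtracted from `j`. On
the axis the form grows with the square of the multiple, which leaves room for rounding. -/
lemma EndCondition.exists_sub_one {a b r : ℝ} {p q i N : ℕ} (h : EndCondition a b r p q i N)
    (hF : 0 ≤ discForm a b r p q i) (hne : p ≠ 0 ∨ q ≠ 0) {s : ℝ} (hs : 1 ≤ s)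
    (hN : N ≤ (s - 1) ^ 2) {j : ℕ} (hj : 0 ≤ discForm a b r (s * p) (s * q) j) :
    ∃ m : ℕ, 0 ≤ discForm a b r ((s - 1) * p) ((s - 1) * q) m := by
  have hi : (0 : ℝ) < i := pos_of_discForm_nonneg hF (Nat.cast_nonneg _) (by exact_mod_cast hne)
  rcases h with ⟨h0, h1⟩ | ⟨h0, h1⟩
  · have hpq : 0 < (p : ℝ) ^ 2 + (q : ℝ) ^ 2 := by
      rcases hne with h | h <;> have : (0 : ℝ) < _ := Nat.cast_pos.2 (Nat.pos_of_ne_zero h) <;>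
        positivity
    have e := eq_of_support hpq h1 hF hj
    have hij : i ≤ j := by
      have : (i : ℝ) ≤ j := by rw [e]; nlinarith
      exact_mod_cast this
    refine ⟨j - i, ?_⟩
    rw [Nat.cast_sub hij, show (j : ℝ) - i = (s - 1) * i by rw [e]; ring, discForm_smul]
    positivity
  · refine exists_nat_discForm_nonneg (t := (s - 1) * i) ?_ ?_
    · exact mul_nonneg (by linarith) hi.le
    · rw [discForm_smul]
      exact h1.trans (by gcongr)

/-! ### Frames and the descent to a box -/

/-- Two lattice vectors on the boundary rays of the cone over the disc, with the constants that
control its integral points. -/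
structure IsFrame (a b r : ℝ) (p q i p' q' i' N : ℕ) : Prop where
  one_le : 1 ≤ N
  det_pos : p * q' < q * p'
  mem_left : 0 ≤ discForm a b r p q i
  mem_right : 0 ≤ discForm a b r p' q' i'
  polar : |a ^ 2 + b ^ 2 - r ^ 2| ≤ N * (2 * discPolar a b r p q i p' q' i')
  end_left : EndCondition a b r p q i N
  end_right : EndCondition b a r q' p' i' N

/-- The mixed term, `2 * (x / D) * (y / D)` times the polar form, alone covers the rounding error.
-/
lemma exists_nat_of_mul_large {a b r : ℝ} {p q i p' q' i' N : ℕ} {D x y m n : ℕ} (hD : 0 < D)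
    (hF : 0 ≤ discForm a b r p q i) (hF' : 0 ≤ discForm a b r p' q' i')
    (hpol : |a ^ 2 + b ^ 2 - r ^ 2| ≤ N * (2 * discPolar a b r p q i p' q' i')) (hN : 1 ≤ N)
    (hm : D * m = x * p + y * p') (hn : D * n = x * q + y * q') (hxy : N * D ^ 2 ≤ x * y) :
    ∃ j : ℕ, 0 ≤ discForm a b r m n j := by
  have hD' : (0 : ℝ) < D := by exact_mod_cast hD
  have hN' : (0 : ℝ) < N := by exact_mod_cast hN
  have hm' : (m : ℝ) = x / D * p + y / D * p' := by
    field_simp; rw [mul_comm]; exact_mod_cast hm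
  have hn' : (n : ℝ) = x / D * q + y / D * q' := by
    field_simp; rw [mul_comm]; exact_mod_cast hn
  have hxy' : (N : ℝ) ≤ x / D * (y / D) := by
    rw [div_mul_div_comm, le_div_iff₀ (by positivity)]
    calc (N : ℝ) * (D * D) = ((N * D ^ 2 : ℕ) : ℝ) := by push_cast; ring
      _ ≤ ((x * y : ℕ) : ℝ) := by exact_mod_cast hxy
      _ = _ := by push_cast; ring
  have hpos : 0 ≤ 2 * discPolar a b r p q i p' q' i' :=
    nonneg_of_mul_nonneg_right ((abs_nonneg _).trans hpol) hN'
  refine exists_nat_discForm_nonneg (t := x / D * i + y / D * i') (by positivity) ?_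
  rw [hm', hn', discForm_comb]
  calc _ ≤ _ := hpol
    _ ≤ x / D * (y / D) * (2 * discPolar a b r p q i p' q' i') := by gcongr
    _ = 0 + 0 + 2 * (x / D) * (y / D) * discPolar a b r p q i p' q' i' := by ring
    _ ≤ _ := by gcongr <;> positivity

/-- The size of a box such that the integral points in it generate the semigroup. -/
def frameBound (p q p' q' N : ℕ) : ℕ := (N * (q * p') ^ 2 + q * p') * (p + q + p' + q')

lemma le_frameBound_of_coords {p q p' q' N D x y m n : ℕ} (hD : 0 < D)
    (hm : D * m = x * p + y * p') (hn : D * n = x * q + y * q')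
    (hx : x ≤ N * (q * p') ^ 2 + q * p') (hy : y ≤ N * (q * p') ^ 2 + q * p') :
    m ≤ frameBound p q p' q' N ∧ n ≤ frameBound p q p' q' N := by
  constructor
  · calc m ≤ D * m := Nat.le_mul_of_pos_left _ hD
      _ = x * p + y * p' := hm
      _ ≤ (N * (q * p') ^ 2 + q * p') * p + (N * (q * p') ^ 2 + q * p') * p' := by gcongr
      _ = (N * (q * p') ^ 2 + q * p') * (p + p') := by ring
      _ ≤ _ := Nat.mul_le_mul_left _ (by omega)
  · calc n ≤ D * n := Nat.le_mul_of_pos_left _ hD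
      _ = x * q + y * q' := hn
      _ ≤ (N * (q * p') ^ 2 + q * p') * q + (N * (q * p') ^ 2 + q * p') * q' := by gcongr
      _ = (N * (q * p') ^ 2 + q * p') * (q + q') := by ring
      _ ≤ _ := Nat.mul_le_mul_left _ (by omega)

lemma IsFrame.exists_coords {a b r : ℝ} {p q i p' q' i' N : ℕ}
    (h : IsFrame a b r p q i p' q' i' N) {m n : ℕ} (h1 : p * n ≤ q * m) (h2 : q' * m ≤ p' * n) :
    ∃ D x y : ℕ, 0 < D ∧ D ≤ q * p' ∧ D * m = x * p + y * p' ∧ D * n = x * q + y * q' ∧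
      p * n + y = q * m ∧ q' * m + x = p' * n := by
  -- Cramer's rule: the determinant `q * p' - p * q'` equals `D + 1` for this `D`, and the
  -- coordinates are the two other minors.
  obtain ⟨D, hD⟩ := Nat.exists_eq_add_of_lt h.det_pos
  obtain ⟨y, hy⟩ := Nat.exists_eq_add_of_le h1
  obtain ⟨x, hx⟩ := Nat.exists_eq_add_of_le h2
  refine ⟨D + 1, x, y, by omega, by omega, ?_, ?_, hy.symm, hx.symm⟩
  · zify at *; linear_combination (-m : ℤ) * hD + p * hx + p' * hy
  · zify at *; linear_combination (-n : ℤ) * hD + q * hx + q' * hy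

lemma exists_sub_of_collinear {a b r : ℝ} {p q i N D x m n j : ℕ} (h : EndCondition a b r p q i N)
    (hF : 0 ≤ discForm a b r p q i) (hne : p ≠ 0 ∨ q ≠ 0) (hD : 0 < D)
    (hx : N * D ^ 2 ≤ x) (hm : D * m = x * p) (hn : D * n = x * q)
    (hj : 0 ≤ discForm a b r (m + p) (n + q) j) : ∃ j' : ℕ, 0 ≤ discForm a b r m n j' := by
  have hD' : (0 : ℝ) < D := by exact_mod_cast hD
  have hm' : (m : ℝ) = x / D * p := by field_simp; rw [mul_comm]; exact_mod_cast hm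
  have hn' : (n : ℝ) = x / D * q := by field_simp; rw [mul_comm]; exact_mod_cast hn
  have hj' : 0 ≤ discForm a b r ((x / D + 1) * p) ((x / D + 1) * q) j := by
    rwa [add_one_mul, add_one_mul, ← hm', ← hn']
  obtain ⟨j', h'⟩ := h.exists_sub_one hF hne (by simp; positivity) (by
    rw [add_sub_cancel_right, div_pow, le_div_iff₀ (by positivity)]
    have : N * D ^ 2 ≤ x ^ 2 := by nlinarith
    exact_mod_cast this) hj'
  rw [add_sub_cancel_right, ← hm', ← hn'] at h'
  exact ⟨j', h'⟩

lemma IsFrame.exists_sub {a b r : ℝ} {p q i p' q' i' N : ℕ}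
    (h : IsFrame a b r p q i p' q' i' N) {m n j : ℕ} (hj : 0 ≤ discForm a b r m n j)
    (hbox : ¬ (m ≤ frameBound p q p' q' N ∧ n ≤ frameBound p q p' q' N)) :
    (∃ m' n' j' : ℕ, m = m' + p ∧ n = n' + q ∧ 0 ≤ discForm a b r m' n' j') ∨
      (∃ m' n' j' : ℕ, m = m' + p' ∧ n = n' + q' ∧ 0 ≤ discForm a b r m' n' j') := by
  have hl : p * n ≤ q * m := by
    have := h.end_left.nonneg (Nat.cast_nonneg m) (Nat.cast_nonneg j) hj
    have : (p : ℝ) * n ≤ q * m := by linarith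
    exact_mod_cast this
  have hr : q' * m ≤ p' * n := by
    have := h.end_right.nonneg (Nat.cast_nonneg n) (Nat.cast_nonneg j)
      (by rw [discForm_swap]; exact hj)
    have : (q' : ℝ) * m ≤ p' * n := by linarith
    exact_mod_cast this
  obtain ⟨D, x, y, hD, hDle, hm, hn, -, -⟩ := h.exists_coords hl hr
  have hq : q ≠ 0 := by rintro rfl; have := h.det_pos; omega
  have hp' : p' ≠ 0 := by rintro rfl; have := h.det_pos; omega
  -- Subtracting `(p, q)` lowers `x` by `D`, so at least `N * D ^ 2` remains. This suffices by the
  -- product criterion if `y ≥ 1`, and by the condition on the ray itself if `y = 0`.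
  by_cases hx : N * D ^ 2 + D ≤ x
  · left
    obtain ⟨x', rfl⟩ := Nat.exists_eq_add_of_le (le_of_add_le_right hx)
    have hx' : N * D ^ 2 ≤ x' := by omega
    obtain ⟨m', rfl⟩ := Nat.exists_eq_add_of_le' (show p ≤ m by
      apply Nat.le_of_mul_le_mul_left _ hD; rw [hm, add_mul]; omega)
    obtain ⟨n', rfl⟩ := Nat.exists_eq_add_of_le' (show q ≤ n by
      apply Nat.le_of_mul_le_mul_left _ hD; rw [hn, add_mul]; omega)
    have hm' : D * m' = x' * p + y * p' := by linarith
    have hn' : D * n' = x' * q + y * q' := by linarith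
    rcases Nat.eq_zero_or_pos y with rfl | hy
    · obtain ⟨j', hj'⟩ := exists_sub_of_collinear h.end_left h.mem_left (Or.inr hq) hD hx'
        (by simpa using hm') (by simpa using hn') (by exact_mod_cast hj)
      exact ⟨m', n', j', rfl, rfl, hj'⟩
    · obtain ⟨j', hj'⟩ := exists_nat_of_mul_large hD h.mem_left h.mem_right h.polar h.one_le hm' hn'
        (hx'.trans (Nat.le_mul_of_pos_right _ hy))
      exact ⟨m', n', j', rfl, rfl, hj'⟩
  by_cases hy : N * D ^ 2 + D ≤ y
  · right
    obtain ⟨y', rfl⟩ := Nat.exists_eq_add_of_le (le_of_add_le_right hy)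
    have hy' : N * D ^ 2 ≤ y' := by omega
    obtain ⟨m', rfl⟩ := Nat.exists_eq_add_of_le' (show p' ≤ m by
      apply Nat.le_of_mul_le_mul_left _ hD; rw [hm, add_mul]; omega)
    obtain ⟨n', rfl⟩ := Nat.exists_eq_add_of_le' (show q' ≤ n by
      apply Nat.le_of_mul_le_mul_left _ hD; rw [hn, add_mul]; omega)
    have hm' : D * m' = x * p + y' * p' := by linarith
    have hn' : D * n' = x * q + y' * q' := by linarith
    rcases Nat.eq_zero_or_pos x with rfl | hx
    · obtain ⟨j', hj'⟩ := exists_sub_of_collinear h.end_right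
        (by rw [discForm_swap]; exact h.mem_right) (Or.inr hp') hD hy'
        (by simpa using hn') (by simpa using hm') (j := j)
        (by rw [discForm_swap]; exact_mod_cast hj)
      exact ⟨m', n', j', rfl, rfl, by rw [discForm_swap] at hj'; exact hj'⟩
    · obtain ⟨j', hj'⟩ := exists_nat_of_mul_large hD h.mem_left h.mem_right h.polar h.one_le hm' hn'
        (hy'.trans (Nat.le_mul_of_pos_left _ hx))
      exact ⟨m', n', j', rfl, rfl, hj'⟩
  have hB : N * D ^ 2 + D ≤ N * (q * p') ^ 2 + q * p' := by gcongr
  exact absurd (le_frameBound_of_coords hD hm hn (by omega) (by omega)) hbox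

lemma IsFrame.le_frameBound {a b r : ℝ} {p q i p' q' i' N : ℕ}
    (h : IsFrame a b r p q i p' q' i' N) :
    p + q + p' + q' ≤ frameBound p q p' q' N := by
  have := h.det_pos
  have h1 : 1 ≤ q * p' := by omega
  exact Nat.le_mul_of_pos_left _ (by omega)

/-! ### The semigroup in terms of the quadratic form -/

lemma mem_disc_iff {a b r : ℝ} (hr : 0 ≤ r) {X : Plane} :
    X ∈ disc a b r ↔ 0 ≤ discForm a b r (X 0) (X 1) 1 := by
  rw [disc, Metric.mem_closedBall, EuclideanSpace.dist_eq, Real.sqrt_le_left hr]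
  simp [Fin.sum_univ_two, Real.dist_eq, discForm]
  constructor <;> intro h <;> linarith

lemma mem_discSemigroup_iff {a b r : ℝ} (hr : 0 < r) {n : ℕ × ℕ} :
    n ∈ discSemigroup a b r hr ↔ ∃ i : ℕ, 0 ≤ discForm a b r n.1 n.2 i := by
  change (∃ i : ℕ, ∃ X ∈ disc a b r, latticePoint n = (i : ℝ) • X) ↔ _
  constructor
  · rintro ⟨i, X, hX, h⟩
    rw [mem_disc_iff hr.le] at hX
    have h0 : (n.1 : ℝ) = i * X 0 := by simpa [latticePoint] using congrArg (· 0) h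
    have h1 : (n.2 : ℝ) = i * X 1 := by simpa [latticePoint] using congrArg (· 1) h
    refine ⟨i, ?_⟩
    rw [h0, h1, ← mul_one (i : ℝ), mul_one (i : ℝ)]
    nth_rewrite 3 [← mul_one (i : ℝ)]
    rw [discForm_smul]
    positivity
  · rintro ⟨i, h⟩
    rcases Nat.eq_zero_or_pos i with rfl | hi
    · refine ⟨0, !₂[a, b], Metric.mem_closedBall_self hr.le, ?_⟩
      simp [discForm] at h
      have h0 : (n.1 : ℝ) = 0 := by nlinarith
      have h1 : (n.2 : ℝ) = 0 := by nlinarith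
      ext j; fin_cases j <;> simp [latticePoint, h0, h1]
    · have hi' : (0 : ℝ) < i := by exact_mod_cast hi
      refine ⟨i, !₂[(n.1 : ℝ) / i, (n.2 : ℝ) / i], ?_, ?_⟩
      · rw [mem_disc_iff hr.le]
        have := discForm_smul a b r ((n.1 : ℝ) / i) ((n.2 : ℝ) / i) 1 i
        rw [mul_div_cancel₀ _ hi'.ne', mul_div_cancel₀ _ hi'.ne', mul_one] at this
        rw [this] at h
        exact nonneg_of_mul_nonneg_right h (by positivity)
      · ext j; fin_cases j <;> simp [latticePoint, mul_div_cancel₀ _ hi'.ne']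

lemma discSemigroup_eq_bot {a b r : ℝ} (hr : 0 < r) (h : disc a b r ∩ quadrant = ∅) :
    discSemigroup a b r hr = ⊥ := by
  rw [eq_bot_iff]
  rintro n ⟨i, X, hX, hn⟩
  have h0 : (n.1 : ℝ) = i * X 0 := by simpa [latticePoint] using congrArg (· 0) hn
  have h1 : (n.2 : ℝ) = i * X 1 := by simpa [latticePoint] using congrArg (· 1) hn
  rcases Nat.eq_zero_or_pos i with rfl | hi
  · simp at h0 h1
    exact Prod.ext h0 h1
  · have hi' : (0 : ℝ) < i := by exact_mod_cast hi
    have : X ∈ disc a b r ∩ quadrant := ⟨hX, nonneg_of_mul_nonneg_right (h0 ▸ Nat.cast_nonneg _) hi',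
      nonneg_of_mul_nonneg_right (h1 ▸ Nat.cast_nonneg _) hi'⟩
    rw [h] at this
    exact this.elim

lemma discSemigroup_subset_integerCone {a b r : ℝ} (hr : 0 < r) :
    (discSemigroup a b r hr : Set (ℕ × ℕ)) ⊆ integerCone a b r := by
  rintro n ⟨i, X, hX, hn⟩
  have h0 : (n.1 : ℝ) = i * X 0 := by simpa [latticePoint] using congrArg (· 0) hn
  have h1 : (n.2 : ℝ) = i * X 1 := by simpa [latticePoint] using congrArg (· 1) hn
  change latticePoint n ∈ rationalCone (disc a b r ∩ quadrant)
  rcases Nat.eq_zero_or_pos i with rfl | hi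
  · rw [hn]; simp
  · have hi' : (0 : ℝ) < i := by exact_mod_cast hi
    have : X ∈ disc a b r ∩ quadrant := ⟨hX, nonneg_of_mul_nonneg_right (h0 ▸ Nat.cast_nonneg _) hi',
      nonneg_of_mul_nonneg_right (h1 ▸ Nat.cast_nonneg _) hi'⟩
    rw [hn, Nat.cast_smul_eq_nsmul]
    exact nsmul_mem (Submodule.subset_span this) i

/-! ### Extremal rays in coordinates -/

/-- By extremality, a combination of generators that lies on the ray only involves generators on the
ray. -/
lemma IsExtremalRay.exists_mem {A : Set Plane} {τ : Submodule ℝ Plane}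
    (h : IsExtremalRay (rationalCone A) τ) : ∃ P ∈ A, P ∈ τ ∧ P ≠ 0 := by
  obtain ⟨-, ⟨X, hX, hXτ, hX0⟩, hext⟩ := h
  by_contra! hcon
  apply hX0
  refine Submodule.span_induction (p := fun X _ => X ∈ τ → X = 0) (fun X hX hXτ => hcon X hX hXτ)
    (fun _ => rfl) ?_ ?_ hX hXτ
  · intro X Y hX hY h1 h2 h3
    obtain ⟨h4, h5⟩ := hext X hX Y hY h3
    rw [h1 h4, h2 h5, add_zero]
  · intro q X _ h1 h2
    rcases eq_or_ne q 0 with rfl | hq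
    · simp
    · have : X ∈ τ := by
        have h3 : X = ((q : ℝ)⁻¹) • (q • X) := by
          have h4 : q • X = (q : ℝ) • X := by ext j; simp [NNRat.smul_def]
          rw [h4, inv_smul_smul₀ (by exact_mod_cast hq)]
        rw [h3]; exact τ.smul_mem _ h2
      rw [h1 this, smul_zero]

lemma mem_iff_of_finrank_eq_one {τ : Submodule ℝ Plane} (h : Module.finrank ℝ τ = 1) {P : Plane}
    (hP : P ∈ τ) (h0 : P ≠ 0) (X : Plane) : X ∈ τ ↔ P 1 * X 0 = P 0 * X 1 := by
  constructor
  · intro hX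
    have := (finrank_eq_one_iff_of_nonzero' (⟨P, hP⟩ : τ) (by simpa using h0)).1 h ⟨X, hX⟩
    obtain ⟨c, hc⟩ := this
    have hc' : c • P = X := congrArg Subtype.val hc
    rw [← hc']; simp; ring
  · intro hX
    by_cases hP0 : P 0 = 0
    · have hP1 : P 1 ≠ 0 := by
        intro hP1; apply h0; ext j; fin_cases j <;> simp [hP0, hP1]
      have : X = (X 1 / P 1) • P := by
        have : X 0 = 0 := by
          rw [hP0, zero_mul] at hX; exact (mul_eq_zero.1 hX).resolve_left hP1
        ext j; fin_cases j <;> simp [this, hP0, hP1]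
      rw [this]; exact τ.smul_mem _ hP
    · have : X = (X 0 / P 0) • P := by
        ext j; fin_cases j
        · simp [hP0]
        · simp; field_simp; linarith
      rw [this]; exact τ.smul_mem _ hP

/-- A segment of `A` that crosses the line contains two points symmetric about the crossing. Their
sum is on the line although neither of them is. -/
lemma IsExtremalRay.not_separates {A : Set Plane} (hA : Convex ℝ A) {τ : Submodule ℝ Plane}
    (h : IsExtremalRay (rationalCone A) τ) (f : Plane →ₗ[ℝ] ℝ) (hf : ∀ X, X ∈ τ ↔ f X = 0)
    {X Y : Plane} (hX : X ∈ A) (hY : Y ∈ A) (hfY : 0 < f Y) : 0 ≤ f X := by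
  by_contra! hfX
  set d := f Y - f X with hd
  have hd0 : 0 < d := by linarith
  have hmem : ∀ t : ℝ, 0 ≤ t → t ≤ 1 → (1 - t) • X + t • Y ∈ A := fun t h0 h1 =>
    hA hX hY (by linarith) h0 (by ring)
  -- These bounds keep `t - e` and `t + e` in `[0, 1]`, where `t` is the parameter of the crossing.
  obtain ⟨e, he0, he1, he2⟩ : ∃ e : ℝ, 0 < e ∧ e * d ≤ - f X ∧ e * d ≤ f Y := by
    refine ⟨min (- f X) (f Y) / d, div_pos (lt_min (by linarith) hfY) hd0, ?_, ?_⟩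
    · rw [div_mul_cancel₀ _ hd0.ne']; exact min_le_left _ _
    · rw [div_mul_cancel₀ _ hd0.ne']; exact min_le_right _ _
  obtain ⟨t, ht⟩ : ∃ t : ℝ, t * d = - f X := ⟨- f X / d, div_mul_cancel₀ _ hd0.ne'⟩
  have h1 := hmem (t - e) (by nlinarith) (by nlinarith)
  have h2 := hmem (t + e) (by nlinarith) (by nlinarith)
  set U := (1 - (t - e)) • X + (t - e) • Y with hU
  set V := (1 - (t + e)) • X + (t + e) • Y with hV
  have hfU : f U = - (e * d) := by
    rw [hU]; simp only [map_add, map_smul, smul_eq_mul]; rw [hd] at ht ⊢; linarith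
  have hfV : f V = e * d := by
    rw [hV]; simp only [map_add, map_smul, smul_eq_mul]; rw [hd] at ht ⊢; linarith
  have h3 := h.2.2 U (Submodule.subset_span h1) V (Submodule.subset_span h2)
    ((hf _).2 (by rw [map_add, hfU, hfV]; ring))
  have h4 := (hf _).1 h3.2
  rw [hfV] at h4
  nlinarith

/-- The points `(x, y)` and `(x', y')` of the disc span the left and the right boundary ray of the
part of the disc in the quadrant. -/
structure IsRayPair (a b r x y x' y' : ℝ) : Prop where
  nonneg_x : 0 ≤ x
  nonneg_y : 0 ≤ y
  nonneg_x' : 0 ≤ x'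
  nonneg_y' : 0 ≤ y'
  mem : 0 ≤ discForm a b r x y 1
  mem' : 0 ≤ discForm a b r x' y' 1
  det_pos : x * y' < y * x'
  left : ∀ u v : ℝ, 0 ≤ u → 0 ≤ v → 0 ≤ discForm a b r u v 1 → 0 ≤ y * u - x * v
  right : ∀ u v : ℝ, 0 ≤ u → 0 ≤ v → 0 ≤ discForm a b r u v 1 → 0 ≤ x' * v - y' * u

lemma IsRayPair.swap {a b r x y x' y' : ℝ} (h : IsRayPair a b r x y x' y') :
    IsRayPair b a r y' x' y x where
  nonneg_x := h.nonneg_y'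
  nonneg_y := h.nonneg_x'
  nonneg_x' := h.nonneg_y
  nonneg_y' := h.nonneg_x
  mem := by rw [discForm_swap]; exact h.mem'
  mem' := by rw [discForm_swap]; exact h.mem
  det_pos := by have := h.det_pos; linarith
  left := fun u v hu hv hF => h.right v u hv hu (by rw [discForm_swap] at hF; exact hF)
  right := fun u v hu hv hF => h.left v u hv hu (by rw [discForm_swap] at hF; exact hF)

lemma IsRayPair.pos_y {a b r x y x' y' : ℝ} (h : IsRayPair a b r x y x' y') : 0 < y := by
  rcases h.nonneg_y.eq_or_lt with h0 | h0
  · have := h.det_pos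
    rw [← h0, zero_mul] at this
    have := mul_nonneg h.nonneg_x h.nonneg_y'
    linarith
  · exact h0

lemma convex_quadrant : Convex ℝ quadrant := by
  intro X hX Y hY s t hs ht _
  have := hX.1; have := hX.2; have := hY.1; have := hY.2
  constructor <;> simp <;> positivity

/-- Trades extremality in the rational cone for real inequalities: `exists_mem` supplies points of
the disc on the rays, and `not_separates` puts the part of the disc in the quadrant on one side of
each. -/
lemma AreExtremalRays.exists_isRayPair {a b r : ℝ} (hr : 0 < r) {τ₁ τ₂ : Submodule ℝ Plane}
    (h : AreExtremalRays a b r τ₁ τ₂) : ∃ x y x' y' : ℝ, IsRayPair a b r x y x' y' ∧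
      (∀ X : Plane, X ∈ τ₁ ↔ y * X 0 = x * X 1) ∧ (∀ X : Plane, X ∈ τ₂ ↔ y' * X 0 = x' * X 1) := by
  obtain ⟨h1, h2, u, hu, v, hv, huQ, hvQ, huv⟩ := h
  obtain ⟨P, hPA, hPτ, hP0⟩ := h1.exists_mem
  obtain ⟨Q, hQA, hQτ, hQ0⟩ := h2.exists_mem
  have m1 := mem_iff_of_finrank_eq_one h1.1 hPτ hP0
  have m2 := mem_iff_of_finrank_eq_one h2.1 hQτ hQ0
  have hA : Convex ℝ (disc a b r ∩ quadrant) := (convex_closedBall _ _).inter convex_quadrant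
  have hdet : P 0 * Q 1 < P 1 * Q 0 := by
    have e1 := (m1 u).1 hu
    have e2 := (m2 v).1 hv
    obtain ⟨hP₀, hP₁⟩ := hPA.2
    obtain ⟨hQ₀, hQ₁⟩ := hQA.2
    obtain ⟨hu₀, hu₁⟩ := huQ
    obtain ⟨hv₀, hv₁⟩ := hvQ
    have hu1 : 0 < u 1 := by
      rcases hu₁.eq_or_lt with h0 | h0
      · rw [← h0, zero_mul] at huv; have := mul_nonneg hv₁ hu₀; linarith
      · exact h0
    have hv0 : 0 < v 0 := by
      rcases hv₀.eq_or_lt with h0 | h0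
      · rw [← h0, mul_zero] at huv; have := mul_nonneg hv₁ hu₀; linarith
      · exact h0
    have hP1 : 0 < P 1 := by
      rcases hP₁.eq_or_lt with h0 | h0
      · exfalso; apply hP0
        rw [← h0, zero_mul] at e1
        have : P 0 = 0 := (mul_eq_zero.1 e1.symm).resolve_right hu1.ne'
        ext j; fin_cases j <;> simp [this, ← h0]
      · exact h0
    have hQ0' : 0 < Q 0 := by
      rcases hQ₀.eq_or_lt with h0 | h0
      · exfalso; apply hQ0
        rw [← h0, zero_mul] at e2
        have : Q 1 = 0 := (mul_eq_zero.1 e2).resolve_right hv0.ne'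
        ext j; fin_cases j <;> simp [this, ← h0]
      · exact h0
    have e3 : P 0 * Q 1 * (u 1 * v 0) = P 1 * Q 0 * (v 1 * u 0) := by
      linear_combination (-(Q 1 * v 0)) * e1 + (P 1 * u 0) * e2
    have e4 : P 1 * Q 0 * (v 1 * u 0) < P 1 * Q 0 * (u 1 * v 0) := by gcongr
    rw [← e3] at e4
    exact lt_of_mul_lt_mul_right e4 (by positivity)
  let coord : Fin 2 → (Plane →ₗ[ℝ] ℝ) := fun i => (EuclideanSpace.proj (𝕜 := ℝ) i).toLinearMap
  refine ⟨P 0, P 1, Q 0, Q 1, ⟨hPA.2.1, hPA.2.2, hQA.2.1, hQA.2.2, (mem_disc_iff hr.le).1 hPA.1,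
    (mem_disc_iff hr.le).1 hQA.1, hdet, ?_, ?_⟩, m1, m2⟩
  · intro u v hu hv hF
    have := h1.not_separates hA (P 1 • coord 0 - P 0 • coord 1)
      (fun X => by rw [m1]; simp [coord, sub_eq_zero]) (X := !₂[u, v]) (Y := Q)
      ⟨(mem_disc_iff hr.le).2 (by simpa using hF), by simpa using hu, by simpa using hv⟩ hQA
      (by simp [coord]; linarith)
    simpa [coord] using this
  · intro u v hu hv hF
    have := h2.not_separates hA (Q 0 • coord 1 - Q 1 • coord 0)
      (fun X => by rw [m2]; simp [coord]; constructor <;> intro h <;> linarith) (X := !₂[u, v]) (Y := P)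
      ⟨(mem_disc_iff hr.le).2 (by simpa using hF), by simpa using hu, by simpa using hv⟩ hPA
      (by simp [coord]; linarith)
    simpa [coord] using this

/-! ### From rational points on the rays to a frame -/

lemma exists_nat_div_eq {u : ℚ} (hu : 0 ≤ u) {v : ℚ} (hv : 0 ≤ v) :
    ∃ p q i : ℕ, 0 < i ∧ (p : ℝ) = i * u ∧ (q : ℝ) = i * v := by
  refine ⟨u.num.toNat * v.den, v.num.toNat * u.den, u.den * v.den,
    Nat.mul_pos u.den_pos v.den_pos, ?_, ?_⟩
  · have h1 : ((u.num.toNat : ℤ) : ℚ) = u.den * u := by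
      rw [Int.toNat_of_nonneg (Rat.num_nonneg.2 hu), mul_comm, Rat.mul_den_eq_num]
    have h2 : (u.num.toNat : ℝ) = u.den * u := by exact_mod_cast h1
    push_cast; rw [h2]; ring
  · have h1 : ((v.num.toNat : ℤ) : ℚ) = v.den * v := by
      rw [Int.toNat_of_nonneg (Rat.num_nonneg.2 hv), mul_comm, Rat.mul_den_eq_num]
    have h2 : (v.num.toNat : ℝ) = v.den * v := by exact_mod_cast h1
    push_cast; rw [h2]; ring

/-- If the disc lies to the right of the line spanned by `(p, q)` then this line is at distance at
least `r` from the center. -/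
lemma support_of_forall {a b r p q : ℝ} (hr : 0 < r) (hq : 0 < q)
    (h : ∀ u v : ℝ, 0 ≤ discForm a b r u v 1 → 0 ≤ q * u - p * v) :
    0 ≤ q * a - p * b ∧ r ^ 2 * (p ^ 2 + q ^ 2) ≤ (q * a - p * b) ^ 2 := by
  have hpos : 0 < p ^ 2 + q ^ 2 := by positivity
  set s := √(p ^ 2 + q ^ 2) with hs
  have hs0 : 0 < s := Real.sqrt_pos.2 hpos
  have hs2 : s ^ 2 = p ^ 2 + q ^ 2 := Real.sq_sqrt hpos.le
  -- The point of the circle farthest to the left of the direction `(p, q)`.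
  have h1 := h (a - r * q / s) (b + r * p / s) (by
    have : discForm a b r (a - r * q / s) (b + r * p / s) 1 =
        r ^ 2 - r ^ 2 * (p ^ 2 + q ^ 2) / s ^ 2 := by
      unfold discForm; field_simp; ring
    rw [this, hs2, mul_div_assoc, div_self hpos.ne']; simp)
  have h2 : q * (a - r * q / s) - p * (b + r * p / s) = q * a - p * b - r * s := by
    have : r * (p ^ 2 + q ^ 2) / s = r * s := by rw [← hs2]; field_simp
    rw [← this]; field_simp; ring
  rw [h2] at h1
  have h3 : 0 < r * s := by positivity
  refine ⟨by linarith, ?_⟩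
  rw [← hs2, ← mul_pow]
  gcongr
  linarith

/-- If `x > 0`, a small move from `(x, y)` towards `(u, v)` stays in the disc and in the quadrant,
but ends to the left of the extremal ray. -/
lemma IsRayPair.eq_zero_of_not_support {a b r x y x' y' : ℝ} (h : IsRayPair a b r x y x' y')
    {u v : ℝ} (hF : 0 ≤ discForm a b r u v 1) (huv : y * u - x * v < 0) : x = 0 := by
  by_contra hx
  have hx0 : 0 < x := lt_of_le_of_ne h.nonneg_x (Ne.symm hx)
  have hy0 := h.pos_y
  -- The two products keep both coordinates non-negative, whatever the signs of `u` and `v`.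
  obtain ⟨e, he0, he1, he2, he3⟩ : ∃ e : ℝ, 0 < e ∧ e ≤ 1 ∧ e * (|u| + x) ≤ x ∧
      e * (|v| + y) ≤ y := by
    refine ⟨min (x / (|u| + x)) (y / (|v| + y)), by positivity, ?_, ?_, ?_⟩
    · refine (min_le_left _ _).trans ((div_le_one (by positivity)).2 ?_)
      linarith [abs_nonneg u]
    · rw [← le_div_iff₀ (by positivity)]; exact min_le_left _ _
    · rw [← le_div_iff₀ (by positivity)]; exact min_le_right _ _
  have h1 := h.left ((1 - e) * x + e * u) ((1 - e) * y + e * v)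
    (by nlinarith [neg_abs_le u]) (by nlinarith [neg_abs_le v]) (by
      have h2 : discForm a b r ((1 - e) * x + e * u) ((1 - e) * y + e * v) 1 =
          (1 - e) * discForm a b r x y 1 + e * discForm a b r u v 1 +
            e * (1 - e) * ((x - u) ^ 2 + (y - v) ^ 2) := by unfold discForm; ring
      have := h.mem
      have : 0 ≤ 1 - e := by linarith
      rw [h2]; positivity)
  nlinarith

/-- If the whole disc is to the right of the ray, the ray is tangent and clearing denominators of
the contact point gives `(p, q)`. Otherwise the ray is the vertical axis, which has rational points
in the interior of the disc. -/
lemma IsRayPair.exists_endCondition {a b r x y x' y' : ℝ} (hr : 0 < r)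
    (h : IsRayPair a b r x y x' y') {u v : ℚ} (hF : 0 ≤ discForm a b r u v 1)
    (huv : y * u = x * v) : ∃ p q i N₀ : ℕ, 0 ≤ discForm a b r p q i ∧ y * p = x * q ∧ q ≠ 0 ∧
      ∀ N ≥ N₀, EndCondition a b r p q i N := by
  have hy := h.pos_y
  by_cases hsup : ∀ u v : ℝ, 0 ≤ discForm a b r u v 1 → 0 ≤ y * u - x * v
  · obtain ⟨s1, s2⟩ := support_of_forall hr hy hsup
    have hu : (u : ℝ) = v / y * x := by field_simp; linarith
    have hv : (v : ℝ) = v / y * y := by field_simp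
    -- The given rational point and `(x, y)` both lie on the tangent, hence coincide.
    have h1 : (1 : ℝ) = v / y * 1 := by
      refine eq_of_support (by positivity) s2 h.mem ?_
      rwa [← hu, ← hv]
    rw [← mul_one (v / y : ℝ), ← h1, one_mul] at hu hv
    have hx := h.nonneg_x
    obtain ⟨p, q, i, hi, hp, hq⟩ := exists_nat_div_eq (u := u) (v := v)
      (by rw [← hu] at hx; exact_mod_cast hx) (by rw [← hv] at hy; exact_mod_cast hy.le)
    have hi' : (0 : ℝ) < i := by exact_mod_cast hi
    rw [hu] at hp; rw [hv] at hq
    refine ⟨p, q, i, 0, ?_, by rw [hp, hq]; ring, ?_, fun N _ => Or.inl ⟨?_, ?_⟩⟩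
    · have := discForm_smul a b r x y 1 i
      rw [mul_one] at this
      rw [hp, hq, this]; have := h.mem; positivity
    · have : (0 : ℝ) < q := by rw [hq]; positivity
      exact_mod_cast this.ne'
    · rw [hp, hq]
      have : (i : ℝ) * y * a - i * x * b = i * (y * a - x * b) := by ring
      rw [this]; positivity
    · rw [hp, hq]
      calc r ^ 2 * (((i : ℝ) * x) ^ 2 + (i * y) ^ 2) = i ^ 2 * (r ^ 2 * (x ^ 2 + y ^ 2)) := by ring
        _ ≤ i ^ 2 * (y * a - x * b) ^ 2 := by gcongr
        _ = _ := by ring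
  · push Not at hsup
    obtain ⟨s, t, hst, hneg⟩ := hsup
    obtain rfl := h.eq_zero_of_not_support hst hneg
    have hs : s < 0 := by nlinarith
    have hx' : 0 < x' := by have := h.det_pos; nlinarith
    have h1 := h.mem
    have h2 := h.mem'
    unfold discForm at hst h1 h2
    -- The disc has points strictly on both sides of the axis, so the axis passes through its
    -- interior.
    have ha1 : a < r := by
      have := abs_le_of_sq_le_sq (show (s - a) ^ 2 ≤ r ^ 2 by nlinarith [sq_nonneg (t - 1 * b)]) hr.le
      linarith [(abs_le.1 this).1]
    have ha2 : - r < a := by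
      have := abs_le_of_sq_le_sq (show (x' - a) ^ 2 ≤ r ^ 2 by nlinarith [sq_nonneg (y' - 1 * b)]) hr.le
      linarith [(abs_le.1 this).2]
    have hrho : 0 < r ^ 2 - a ^ 2 := by nlinarith
    obtain ⟨z, hz0, hz⟩ : ∃ z : ℝ, 0 < z ∧ 0 < discForm a b r 0 z 1 := by
      unfold discForm
      -- For `b > 0` the foot of the perpendicular from the center works; otherwise halving `y`
      -- moves strictly closer to that foot.
      rcases lt_or_ge 0 b with hb | hb
      · exact ⟨b, hb, by ring_nf; linarith⟩
      · refine ⟨y / 2, by positivity, ?_⟩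
        nlinarith
    obtain ⟨w, hw0, hw⟩ : ∃ w : ℚ, 0 < (w : ℝ) ∧ 0 < discForm a b r 0 w 1 := by
      have hopen : IsOpen {z : ℝ | 0 < z ∧ 0 < discForm a b r 0 z 1} := by
        have hc : Continuous fun z => discForm a b r 0 z 1 := by unfold discForm; fun_prop
        exact isOpen_Ioi.inter (isOpen_Ioi.preimage hc)
      obtain ⟨w, hw⟩ := Rat.denseRange_cast.exists_mem_open hopen ⟨z, hz0, hz⟩
      exact ⟨w, hw⟩
    obtain ⟨p, q, i, hi, hp, hq⟩ := exists_nat_div_eq (u := 0) le_rfl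
      (v := w) (by exact_mod_cast hw0.le)
    have hi' : (0 : ℝ) < i := by exact_mod_cast hi
    obtain rfl : p = 0 := by simpa using hp
    have hF0 : 0 < discForm a b r (0 : ℕ) q i := by
      have := discForm_smul a b r 0 w 1 i
      rw [mul_one, mul_zero] at this
      rw [hq, Nat.cast_zero, this]; positivity
    refine ⟨0, q, i, ⌈|a ^ 2 + b ^ 2 - r ^ 2| / discForm a b r (0 : ℕ) q i⌉₊, hF0.le, by simp, ?_,
      fun N hN => Or.inr ⟨rfl, ?_⟩⟩
    · have : (0 : ℝ) < q := by rw [hq]; positivity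
      exact_mod_cast this.ne'
    · rw [← div_le_iff₀ hF0]
      exact Nat.ceil_le.1 hN

lemma IsRayPair.exists_isFrame {a b r x y x' y' : ℝ} (hr : 0 < r)
    (h : IsRayPair a b r x y x' y') {u v u' v' : ℚ} (hF : 0 ≤ discForm a b r u v 1)
    (huv : y * u = x * v) (hF' : 0 ≤ discForm a b r u' v' 1) (huv' : y' * u' = x' * v') :
    ∃ p q i p' q' i' N : ℕ, IsFrame a b r p q i p' q' i' N ∧ y * p = x * q ∧
      y' * p' = x' * q' := by
  obtain ⟨p, q, i, N₁, e1, e2, e3, e4⟩ := h.exists_endCondition hr hF huv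
  obtain ⟨q', p', i', N₂, f1, f2, f3, f4⟩ := h.swap.exists_endCondition hr (u := v') (v := u')
    (by rw [discForm_swap]; exact hF') huv'.symm
  rw [discForm_swap] at f1
  have hy := h.pos_y
  have hx' := h.swap.pos_y
  have hq : (0 : ℝ) < q := by exact_mod_cast Nat.pos_of_ne_zero e3
  have hp' : (0 : ℝ) < p' := by exact_mod_cast Nat.pos_of_ne_zero f3
  have hdet : (p : ℝ) * q' < q * p' := by
    have h1 : (p : ℝ) * q' * (y * x') = q * p' * (x * y') := by
      linear_combination (q' * x') * e2 + (x * q) * f2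
    have h2 : (q : ℝ) * p' * (x * y') < q * p' * (y * x') := by
      have := h.det_pos; gcongr
    rw [← h1] at h2
    exact lt_of_mul_lt_mul_right h2 (by positivity)
  have hi := pos_of_discForm_nonneg e1 (Nat.cast_nonneg _) (Or.inr hq.ne')
  have hi' := pos_of_discForm_nonneg f1 (Nat.cast_nonneg _) (Or.inl hp'.ne')
  have hpol := discPolar_pos hi hi' e1 f1 hdet.ne
  -- The polar form is positive, so a large enough `N` meets the last requirement; the other
  -- summands serve the two ends and `1 ≤ N`.
  set N₃ := ⌈|a ^ 2 + b ^ 2 - r ^ 2| / (2 * discPolar a b r p q i p' q' i')⌉₊ with hN₃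
  refine ⟨p, q, i, p', q', i', 1 + N₁ + N₂ + N₃, ⟨by omega, by exact_mod_cast hdet, e1, f1, ?_,
    e4 _ (by omega), f4 _ (by omega)⟩, e2, f2.symm⟩
  rw [← div_le_iff₀ (by positivity)]
  exact Nat.ceil_le.1 (by omega)

/-! ### Finite generation and finiteness of the gaps -/

/-- The semigroup is contained in a monoid which contains all integral points of a box. -/
lemma IsFrame.discSemigroup_le {a b r : ℝ} (hr : 0 < r) {p q i p' q' i' N : ℕ}
    (h : IsFrame a b r p q i p' q' i' N) {T : AddSubmonoid (ℕ × ℕ)}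
    (hT : ∀ n ∈ discSemigroup a b r hr, n ≠ 0 → n.1 ≤ frameBound p q p' q' N →
      n.2 ≤ frameBound p q p' q' N → ∃ g ∈ T, g ≠ 0 ∧ ∃ m ∈ discSemigroup a b r hr, n = g + m) :
    discSemigroup a b r hr ≤ T := by
  have hmem : ((p, q) : ℕ × ℕ) ∈ discSemigroup a b r hr :=
    (mem_discSemigroup_iff hr).2 ⟨i, h.mem_left⟩
  have hmem' : ((p', q') : ℕ × ℕ) ∈ discSemigroup a b r hr :=
    (mem_discSemigroup_iff hr).2 ⟨i', h.mem_right⟩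
  have hW := h.le_frameBound
  have hdet := h.det_pos
  have hq : q ≠ 0 := by rintro rfl; omega
  have hp' : p' ≠ 0 := by rintro rfl; omega
  suffices H : ∀ s : ℕ, ∀ n ∈ discSemigroup a b r hr, n.1 + n.2 = s → n ∈ T from
    fun n hn => H _ n hn rfl
  intro s
  induction s using Nat.strong_induction_on with
  | _ s ih =>
    rintro ⟨m, n⟩ hmn rfl
    have small : ∀ c d : ℕ, (c, d) ∈ discSemigroup a b r hr → c + d < m + n → (c, d) ∈ T :=
      fun c d hcd hlt => ih _ hlt _ hcd rfl
    by_cases hbox : m ≤ frameBound p q p' q' N ∧ n ≤ frameBound p q p' q' N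
    · by_cases h0 : ((m, n) : ℕ × ℕ) = 0
      · rw [h0]; exact T.zero_mem
      obtain ⟨⟨g₁, g₂⟩, hg, hg0, ⟨c, d⟩, hcd, e⟩ := hT _ hmn h0 hbox.1 hbox.2
      rw [e]
      simp only [Prod.mk_add_mk, Prod.mk.injEq] at e
      have : g₁ ≠ 0 ∨ g₂ ≠ 0 := by
        by_contra! hcon; exact hg0 (by simp [hcon])
      exact T.add_mem hg (small _ _ hcd (by omega))
    · obtain ⟨j, hj⟩ := (mem_discSemigroup_iff hr).1 hmn
      rcases h.exists_sub hj hbox with ⟨c, d, k, rfl, rfl, hk⟩ | ⟨c, d, k, rfl, rfl, hk⟩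
      · have hcd := small c d ((mem_discSemigroup_iff hr).2 ⟨k, hk⟩) (by omega)
        exact T.add_mem hcd (small p q hmem (by omega))
      · have hcd := small c d ((mem_discSemigroup_iff hr).2 ⟨k, hk⟩) (by omega)
        exact T.add_mem hcd (small p' q' hmem' (by omega))

lemma IsFrame.fg {a b r : ℝ} (hr : 0 < r) {p q i p' q' i' N : ℕ}
    (h : IsFrame a b r p q i p' q' i' N) : (discSemigroup a b r hr).FG := by
  set W := frameBound p q p' q' N
  set B : Set (ℕ × ℕ) := (discSemigroup a b r hr : Set (ℕ × ℕ)) ∩ Set.Iic (W, W) with hB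
  have hfin : B.Finite := (Set.finite_Iic _).inter_of_right _
  rw [AddSubmonoid.fg_iff]
  refine ⟨B, le_antisymm ?_ ?_, hfin⟩
  · exact (AddSubmonoid.closure_le).2 Set.inter_subset_left
  · refine h.discSemigroup_le hr fun n hn h0 h1 h2 => ?_
    exact ⟨n, AddSubmonoid.subset_closure ⟨hn, h1, h2⟩, h0, 0, zero_mem _, (add_zero n).symm⟩

lemma IsRayPair.nonneg_of_mem_cone {a b r x y x' y' : ℝ} (hr : 0 < r)
    (h : IsRayPair a b r x y x' y') {X : Plane}
    (hX : X ∈ rationalCone (disc a b r ∩ quadrant)) :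
    0 ≤ y * X 0 - x * X 1 ∧ 0 ≤ x' * X 1 - y' * X 0 := by
  refine Submodule.span_induction
    (p := fun X _ => 0 ≤ y * X 0 - x * X 1 ∧ 0 ≤ x' * X 1 - y' * X 0) ?_ (by simp) ?_ ?_ hX
  · intro X hX
    have := (mem_disc_iff hr.le).1 hX.1
    exact ⟨h.left _ _ hX.2.1 hX.2.2 this, h.right _ _ hX.2.1 hX.2.2 this⟩
  · rintro X Y - - ⟨h1, h2⟩ ⟨h3, h4⟩
    simp only [PiLp.add_apply]
    constructor <;> linarith
  · rintro q X - ⟨h1, h2⟩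
    have hq : (0 : ℝ) ≤ q := by positivity
    simp only [PiLp.smul_apply, NNRat.smul_def]
    constructor <;> nlinarith

/-- Off the rays both coordinates are at least 1. For a gap their product is below `N * D ^ 2`,
which therefore bounds each of them. -/
lemma IsFrame.finite_gaps {a b r : ℝ} (hr : 0 < r) {p q i p' q' i' N : ℕ}
    (h : IsFrame a b r p q i p' q' i' N) {x y x' y' : ℝ} (hray : IsRayPair a b r x y x' y')
    (hp : y * p = x * q) (hp' : y' * p' = x' * q') :
    {n : ℕ × ℕ | n ∈ integerCone a b r ∧ ¬ (y * n.1 = x * n.2) ∧ ¬ (y' * n.1 = x' * n.2) ∧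
      n ∉ discSemigroup a b r hr}.Finite := by
  refine (Set.finite_Iic (frameBound p q p' q' N, frameBound p q p' q' N)).subset ?_
  rintro ⟨m, n⟩ ⟨hcone, h1, h2, hS⟩
  obtain ⟨h3, h4⟩ := hray.nonneg_of_mem_cone hr hcone
  simp only [latticePoint, PiLp.toLp_apply, Matrix.cons_val_zero, Matrix.cons_val_one] at h1 h2 h3 h4
  have h3' : 0 < y * m - x * n := lt_of_le_of_ne h3 fun e => h1 (by linarith)
  have h4' : 0 < x' * n - y' * m := lt_of_le_of_ne h4 fun e => h2 (by linarith)
  have hdet := h.det_pos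
  have hq : (0 : ℝ) < q := by
    rcases Nat.eq_zero_or_pos q with rfl | h0
    · omega
    · exact_mod_cast h0
  have hp0' : (0 : ℝ) < p' := by
    rcases Nat.eq_zero_or_pos p' with rfl | h0
    · omega
    · exact_mod_cast h0
  have hl : p * n < q * m := by
    have : 0 < y * ((q : ℝ) * m - p * n) := by
      have e : y * ((q : ℝ) * m - p * n) = q * (y * m - x * n) := by linear_combination (-n : ℝ) * hp
      rw [e]; positivity
    have := pos_of_mul_pos_right this hray.nonneg_y
    have : (p : ℝ) * n < q * m := by linarith
    exact_mod_cast this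
  have hr' : q' * m < p' * n := by
    have : 0 < x' * ((p' : ℝ) * n - q' * m) := by
      have e : x' * ((p' : ℝ) * n - q' * m) = p' * (x' * n - y' * m) := by
        linear_combination (m : ℝ) * hp'
      rw [e]; positivity
    have := pos_of_mul_pos_right this hray.nonneg_x'
    have : (q' : ℝ) * m < p' * n := by linarith
    exact_mod_cast this
  obtain ⟨D, c, d, hD, hDle, hm, hn, hd, hc⟩ := h.exists_coords hl.le hr'.le
  have hcd : c * d < N * D ^ 2 := by
    by_contra! hcon
    obtain ⟨j, hj⟩ := exists_nat_of_mul_large hD h.mem_left h.mem_right h.polar h.one_le hm hn hcon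
    exact hS ((mem_discSemigroup_iff hr).2 ⟨j, hj⟩)
  have hc1 : c ≤ c * d := Nat.le_mul_of_pos_right _ (by omega)
  have hd1 : d ≤ c * d := Nat.le_mul_of_pos_left _ (by omega)
  have hB : N * D ^ 2 + D ≤ N * (q * p') ^ 2 + q * p' := by gcongr
  exact le_frameBound_of_coords hD hm hn (by omega) (by omega)

/-! ### Finite generation forces rational points on the rays -/

lemma mem_discSemigroup_of_rat {a b r : ℝ} (hr : 0 < r) {u v : ℚ} (hu : 0 ≤ u) (hv : 0 ≤ v)
    (hF : 0 ≤ discForm a b r u v 1) :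
    ∃ n ∈ discSemigroup a b r hr, ∃ i : ℝ, 0 < i ∧ (n.1 : ℝ) = i * u ∧ (n.2 : ℝ) = i * v := by
  obtain ⟨p, q, i, hi, hp, hq⟩ := exists_nat_div_eq hu hv
  have hi' : (0 : ℝ) < i := by exact_mod_cast hi
  refine ⟨(p, q), (mem_discSemigroup_iff hr).2 ⟨i, ?_⟩, i, hi', hp, hq⟩
  have := discForm_smul a b r u v 1 i
  rw [mul_one] at this
  simp only [hp, hq, this]
  positivity

lemma IsRayPair.nonneg_of_mem {a b r x y x' y' : ℝ} (hr : 0 < r)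
    (h : IsRayPair a b r x y x' y') {n : ℕ × ℕ} (hn : n ∈ discSemigroup a b r hr) :
    0 ≤ y * n.1 - x * n.2 := by
  have := (h.nonneg_of_mem_cone hr (discSemigroup_subset_integerCone hr hn)).1
  simpa [latticePoint] using this

/-- If the semigroup is finitely generated then it has a non-zero element on the left ray. -/
lemma IsRayPair.exists_mem_left {a b r x y x' y' : ℝ} (hr : 0 < r)
    (h : IsRayPair a b r x y x' y') {G : Set (ℕ × ℕ)} (hG : G.Finite)
    (hcl : AddSubmonoid.closure G = discSemigroup a b r hr) :
    ∃ n ∈ discSemigroup a b r hr, n ≠ 0 ∧ y * n.1 = x * n.2 := by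
  by_contra! hcon
  -- The linear form is positive on each nonzero generator, so finitely many generators share a
  -- constant `e`. The inequality is additive and passes to the whole semigroup.
  obtain ⟨e, he, hG'⟩ : ∃ e : ℝ, 0 < e ∧ ∀ g ∈ G, e * ((g.1 : ℝ) + g.2) ≤ y * g.1 - x * g.2 := by
    have : ∀ g ∈ G, ∀ᶠ e : ℝ in nhdsWithin 0 (Set.Ioi 0),
        e * ((g.1 : ℝ) + g.2) ≤ y * g.1 - x * g.2 := by
      intro g hg
      have hgS : g ∈ discSemigroup a b r hr := hcl ▸ AddSubmonoid.subset_closure hg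
      rcases eq_or_ne g 0 with rfl | hg0
      · simp
      · have h1 := h.nonneg_of_mem hr hgS
        have h2 : 0 < y * g.1 - x * g.2 :=
          lt_of_le_of_ne h1 fun e => hcon g hgS hg0 (by linarith)
        have hc : Continuous fun e : ℝ => e * ((g.1 : ℝ) + g.2) := by fun_prop
        have h3 := Filter.Tendsto.eventually_le_const
          (show (0 : ℝ) * ((g.1 : ℝ) + g.2) < y * g.1 - x * g.2 by rw [zero_mul]; exact h2)
          (hc.tendsto 0)
        exact h3.filter_mono nhdsWithin_le_nhds
    have h4 := (Set.Finite.eventually_all hG).2 this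
    obtain ⟨e, h5, h6⟩ := (h4.and self_mem_nhdsWithin).exists
    exact ⟨e, h6, h5⟩
  have hS : ∀ n ∈ discSemigroup a b r hr, e * ((n.1 : ℝ) + n.2) ≤ y * n.1 - x * n.2 := by
    intro n hn
    rw [← hcl] at hn
    refine AddSubmonoid.closure_induction (motive := fun n _ =>
      e * ((n.1 : ℝ) + n.2) ≤ y * n.1 - x * n.2) hG' (by simp) ?_ hn
    intro m n _ _ h1 h2
    simp only [Prod.fst_add, Prod.snd_add, Nat.cast_add]
    linarith
  have hy := h.pos_y
  have hx' := h.swap.pos_y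
  have hx := h.nonneg_x
  have hy' := h.nonneg_y'
  have hdet := h.det_pos
  -- An open set of points of the disc that violate the inequality; a rational point in it
  -- contradicts `hS`.
  let U : Set (ℝ × ℝ) := {z | 0 < z.1 ∧ 0 < z.2 ∧ 0 < discForm a b r z.1 z.2 1 ∧
    y * z.1 - x * z.2 < e * (z.1 + z.2)}
  have hU : IsOpen U := by
    have hc : Continuous fun z : ℝ × ℝ => discForm a b r z.1 z.2 1 := by unfold discForm; fun_prop
    have ho : IsOpen {z : ℝ × ℝ | y * z.1 - x * z.2 < e * (z.1 + z.2)} :=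
      isOpen_lt (by fun_prop) (by fun_prop)
    exact (isOpen_Ioi.preimage continuous_fst).inter ((isOpen_Ioi.preimage continuous_snd).inter
      ((isOpen_Ioi.preimage hc).inter ho))
  have hne : U.Nonempty := by
    -- On the chord from `(x, y)` to `(x', y')` the linear form is `t * (y * x' - x * y')`, small
    -- with `t`, while the bound stays near `e * (x + y)`. This `t` makes `t * (y * x' - x * y' + e
    -- * y)` half of `e * y`. By strict convexity the chord runs inside the disc.
    obtain ⟨t, ht0, ht1, ht⟩ : ∃ t : ℝ, 0 < t ∧ t < 1 ∧
        t * (y * x' - x * y') < e * ((1 - t) * y) := by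
      have hd : 0 < y * x' - x * y' := by linarith
      refine ⟨e * y / (2 * (y * x' - x * y' + e * y)), by positivity, ?_, ?_⟩
      · rw [div_lt_one (by positivity)]
        have : 0 < e * y := by positivity
        linarith
      · have h0 : 0 < y * x' - x * y' + e * y := by positivity
        have h1 : e * y / (2 * (y * x' - x * y' + e * y)) * (y * x' - x * y' + e * y) =
            e * y / 2 := by field_simp
        have : 0 < e * y := by positivity
        nlinarith
    have h1t : 0 < 1 - t := by linarith
    refine ⟨((1 - t) * x + t * x', (1 - t) * y + t * y'), ?_, ?_, ?_, ?_⟩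
    · simp only; positivity
    · simp only; positivity
    · have h2 : discForm a b r ((1 - t) * x + t * x') ((1 - t) * y + t * y') 1 =
          (1 - t) * discForm a b r x y 1 + t * discForm a b r x' y' 1 +
            t * (1 - t) * ((x - x') ^ 2 + (y - y') ^ 2) := by unfold discForm; ring
      have h3 : 0 < (x - x') ^ 2 + (y - y') ^ 2 := by
        by_contra hcon
        have e1 : x - x' = 0 := by nlinarith
        have e2 : y - y' = 0 := by nlinarith
        rw [sub_eq_zero] at e1 e2
        subst e1 e2
        linarith [mul_comm x y]
      have := h.mem
      have := h.mem'
      simp only [h2]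
      positivity
    · simp only
      have : 0 ≤ e * ((1 - t) * x + t * x' + t * y') := by positivity
      nlinarith
  obtain ⟨⟨u, v⟩, hu, hv, hF, huv⟩ :=
    (Rat.denseRange_cast.prodMap Rat.denseRange_cast).exists_mem_open hU hne
  simp only [Prod.map_apply] at hu hv hF huv
  obtain ⟨n, hn, i, hi, h1, h2⟩ := mem_discSemigroup_of_rat hr (u := u) (v := v)
    (by exact_mod_cast hu.le) (by exact_mod_cast hv.le) hF.le
  have := hS n hn
  rw [h1, h2] at this
  nlinarith

lemma exists_rat_of_mem {a b r : ℝ} (hr : 0 < r) {n : ℕ × ℕ} (hn : n ∈ discSemigroup a b r hr)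
    (h0 : n ≠ 0) : ∃ u v : ℚ, 0 ≤ discForm a b r u v 1 ∧
      ∃ i : ℝ, 0 < i ∧ (n.1 : ℝ) = i * u ∧ (n.2 : ℝ) = i * v := by
  obtain ⟨i, hi⟩ := (mem_discSemigroup_iff hr).1 hn
  have h0' : (n.1 : ℝ) ≠ 0 ∨ (n.2 : ℝ) ≠ 0 := by
    by_contra! hcon
    exact h0 (Prod.ext (by exact_mod_cast hcon.1) (by exact_mod_cast hcon.2))
  have hipos := pos_of_discForm_nonneg hi (Nat.cast_nonneg _) h0'
  have h1 : (n.1 : ℝ) = i * ((n.1 / i : ℚ) : ℝ) := by push_cast; field_simp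
  have h2 : (n.2 : ℝ) = i * ((n.2 / i : ℚ) : ℝ) := by push_cast; field_simp
  refine ⟨n.1 / i, n.2 / i, ?_, i, hipos, h1, h2⟩
  have := discForm_smul a b r (n.1 / i : ℚ) (n.2 / i : ℚ) 1 i
  rw [← h1, ← h2, mul_one] at this
  rw [this] at hi
  exact nonneg_of_mul_nonneg_right hi (by positivity)

/-- Reflection in the diagonal. -/
lemma discSemigroup_map_swap {a b r : ℝ} (hr : 0 < r) :
    (discSemigroup a b r hr).map (AddEquiv.prodComm : ℕ × ℕ ≃+ ℕ × ℕ).toAddMonoidHom = discSemigroup b a r hr := by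
  ext n
  simp only [AddSubmonoid.mem_map, mem_discSemigroup_iff]
  constructor
  · rintro ⟨m, ⟨i, hi⟩, rfl⟩
    exact ⟨i, by rw [discForm_swap]; exact hi⟩
  · rintro ⟨i, hi⟩
    exact ⟨n.swap, ⟨i, by rw [discForm_swap]; exact hi⟩, by simp⟩

lemma IsRayPair.exists_rat_left {a b r x y x' y' : ℝ} (hr : 0 < r)
    (h : IsRayPair a b r x y x' y') (hfg : (discSemigroup a b r hr).FG) :
    ∃ u v : ℚ, 0 ≤ discForm a b r u v 1 ∧ y * u = x * v := by
  obtain ⟨G, hG, hfin⟩ := (AddSubmonoid.fg_iff _).1 hfg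
  obtain ⟨n, hn, h0, hxy⟩ := h.exists_mem_left hr hfin hG
  obtain ⟨u, v, hF, i, hi, h1, h2⟩ := exists_rat_of_mem hr hn h0
  refine ⟨u, v, hF, ?_⟩
  rw [h1, h2] at hxy
  apply mul_left_cancel₀ hi.ne'
  linarith

lemma IsRayPair.exists_rat_right {a b r x y x' y' : ℝ} (hr : 0 < r)
    (h : IsRayPair a b r x y x' y') (hfg : (discSemigroup a b r hr).FG) :
    ∃ u v : ℚ, 0 ≤ discForm a b r u v 1 ∧ y' * u = x' * v := by
  obtain ⟨u, v, hF, huv⟩ := h.swap.exists_rat_left hr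
    (by rw [← discSemigroup_map_swap hr]; exact hfg.map _)
  exact ⟨v, u, by rw [discForm_swap] at hF; exact hF, huv.symm⟩

lemma hasRationalPoint_iff {a b r : ℝ} (hr : 0 < r) {x y : ℝ} {τ : Submodule ℝ Plane}
    (hτ : ∀ X : Plane, X ∈ τ ↔ y * X 0 = x * X 1) :
    HasRationalPoint (disc a b r ∩ τ) ↔ ∃ u v : ℚ, 0 ≤ discForm a b r u v 1 ∧ y * u = x * v := by
  simp [HasRationalPoint, mem_disc_iff hr.le, hτ]

/-! ### Discs that contain the origin -/

/-- If two extremal rays exist and the origin lies on the circle, then the center lies inside of the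
quadrant. -/
lemma IsRayPair.pos_left {a b r x y x' y' : ℝ} (h : IsRayPair a b r x y x' y')
    (hk : a ^ 2 + b ^ 2 - r ^ 2 = 0) : 0 < a := by
  by_contra! ha
  have hx' := h.swap.pos_y
  have hF : ∀ u v, discForm a b r u v 1 = 2 * (u * a + v * b) - (u ^ 2 + v ^ 2) := by
    intro u v; rw [discForm_expand, hk]; ring
  have h1 := h.mem'
  rw [hF] at h1
  have h2 : 0 < x' * a + y' * b := by nlinarith [sq_nonneg y', sq_pos_of_pos hx']
  have h3 : x' * a ≤ 0 := mul_nonpos_of_nonneg_of_nonpos hx'.le ha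
  have h4 : 0 < y' * b := by linarith
  have hb : 0 < b := pos_of_mul_pos_right h4 h.nonneg_y'
  -- With the origin on the circle, a direction `(u, v)` meets the disc outside the origin iff `u *
  -- a + v * b > 0`. This open condition survives lowering `y'` to `w`, which gives a direction
  -- beyond the right ray.
  obtain ⟨w, hw0, hw1, hw⟩ : ∃ w, 0 ≤ w ∧ w < y' ∧ 0 < x' * a + w * b := by
    refine ⟨y' - (x' * a + y' * b) / (2 * b), ?_, ?_, ?_⟩
    · rw [sub_nonneg, div_le_iff₀ (by positivity)]; nlinarith
    · have : 0 < (x' * a + y' * b) / (2 * b) := by positivity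
      linarith
    · have : (x' * a + y' * b) / (2 * b) * b = (x' * a + y' * b) / 2 := by field_simp
      nlinarith
  set t := (x' * a + w * b) / (x' ^ 2 + w ^ 2) with ht
  have ht0 : 0 < t := by positivity
  have ht1 : t * (x' ^ 2 + w ^ 2) = x' * a + w * b := by rw [ht]; field_simp
  have := h.right (t * x') (t * w) (by positivity) (by positivity) (by
    rw [hF]
    have : 2 * (t * x' * a + t * w * b) - ((t * x') ^ 2 + (t * w) ^ 2) =
        t * (x' * a + w * b) := by linear_combination (-t) * ht1
    rw [this]; positivity)
  have h5 : x' * (t * w) - y' * (t * x') = t * x' * (w - y') := by ring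
  rw [h5] at this
  have : 0 < t * x' * (y' - w) := mul_pos (by positivity) (by linarith)
  nlinarith

/-- If the disc contains the origin and spans a cone with two extremal rays, then its semigroup
consists of all lattice points. -/
lemma IsRayPair.mem_of_nonpos {a b r x y x' y' : ℝ} (hr : 0 < r)
    (h : IsRayPair a b r x y x' y') (hk : a ^ 2 + b ^ 2 - r ^ 2 ≤ 0) (n : ℕ × ℕ) :
    n ∈ discSemigroup a b r hr := by
  rcases eq_or_ne n 0 with rfl | hn
  · exact zero_mem _
  rw [mem_discSemigroup_iff]
  set s := (n.1 : ℝ) * a + n.2 * b with hs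
  suffices H : ∃ i : ℕ, (n.1 : ℝ) ^ 2 + (n.2 : ℝ) ^ 2 ≤
      i * (2 * s - (a ^ 2 + b ^ 2 - r ^ 2) * i) by
    obtain ⟨i, hi⟩ := H
    exact ⟨i, by rw [discForm_expand]; linarith⟩
  set k := a ^ 2 + b ^ 2 - r ^ 2 with hk'
  set Q := (n.1 : ℝ) ^ 2 + (n.2 : ℝ) ^ 2 with hQ
  have hQ0 : 0 ≤ Q := by positivity
  -- For `k = 0` the right-hand side grows linearly in `i`, with slope `2 * s > 0`; for `k < 0` it
  -- grows quadratically.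
  rcases hk.eq_or_lt with hk0 | hk0
  · have ha := h.pos_left hk0
    have hb := h.swap.pos_left (by linarith)
    have hs0 : 0 < s := by
      have : n.1 ≠ 0 ∨ n.2 ≠ 0 := by
        by_contra! hcon; exact hn (Prod.ext hcon.1 hcon.2)
      rcases this with h0 | h0 <;> have : (0 : ℝ) < _ := Nat.cast_pos.2 (Nat.pos_of_ne_zero h0) <;>
        positivity
    obtain ⟨i, hi⟩ := exists_nat_ge (Q / (2 * s))
    refine ⟨i, ?_⟩
    rw [div_le_iff₀ (by positivity)] at hi
    rw [hk0]; linarith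
  · obtain ⟨i, hi⟩ := exists_nat_ge (max 1 ((Q - 2 * s) / (-k)))
    refine ⟨i, ?_⟩
    have h1 : (1 : ℝ) ≤ i := (le_max_left _ _).trans hi
    have h2 := (le_max_right _ _).trans hi
    rw [div_le_iff₀ (by linarith)] at h2
    have : Q ≤ 2 * s - k * i := by linarith
    nlinarith

theorem AreExtremalRays.main {a b r : ℝ} (hr : 0 < r) {τ₁ τ₂ : Submodule ℝ Plane}
    (h : AreExtremalRays a b r τ₁ τ₂) :
    ((discSemigroup a b r hr).FG ↔
      HasRationalPoint (disc a b r ∩ τ₁) ∧ HasRationalPoint (disc a b r ∩ τ₂)) ∧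
    ((discSemigroup a b r hr).FG →
      (discSemigroup a b r hr : Set (ℕ × ℕ)) ⊆ integerCone a b r ∧
      {n | n ∈ integerCone a b r ∧ latticePoint n ∉ τ₁ ∧ latticePoint n ∉ τ₂ ∧
        n ∉ discSemigroup a b r hr}.Finite) := by
  obtain ⟨x, y, x', y', hray, hτ₁, hτ₂⟩ := h.exists_isRayPair hr
  rw [hasRationalPoint_iff hr hτ₁, hasRationalPoint_iff hr hτ₂]
  refine ⟨⟨fun hfg => ⟨hray.exists_rat_left hr hfg, hray.exists_rat_right hr hfg⟩, ?_⟩, fun hfg =>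
    ⟨discSemigroup_subset_integerCone hr, ?_⟩⟩
  · rintro ⟨⟨u, v, hF, huv⟩, u', v', hF', huv'⟩
    obtain ⟨p, q, i, p', q', i', N, hframe, -, -⟩ := hray.exists_isFrame hr hF huv hF' huv'
    exact hframe.fg hr
  · obtain ⟨u, v, hF, huv⟩ := hray.exists_rat_left hr hfg
    obtain ⟨u', v', hF', huv'⟩ := hray.exists_rat_right hr hfg
    obtain ⟨p, q, i, p', q', i', N, hframe, e, e'⟩ := hray.exists_isFrame hr hF huv hF' huv'
    refine (hframe.finite_gaps hr hray e e').subset ?_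
    rintro n ⟨h1, h2, h3, h4⟩
    rw [hτ₁] at h2; rw [hτ₂] at h3
    exact ⟨h1, by simpa [latticePoint] using h2, by simpa [latticePoint] using h3, h4⟩

/-! ### Primitive recursion -/

attribute [fun_prop] Primrec
attribute [fun_prop] Primrec.id Primrec.const Primrec.comp Primrec.fst Primrec.snd Primrec.pair

section Primrec

variable {α β σ : Type*} [Primcodable α] [Primcodable β] [Primcodable σ]

lemma Primrec.int_natCast : Primrec (fun n : ℕ => (n : ℤ)) :=
  Primrec.encode_iff.1 (Primrec.nat_double.of_eq fun _ => rfl)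

lemma Primrec.int_neg_natCast : Primrec (fun n : ℕ => -(n : ℤ)) := by
  refine Primrec.encode_iff.1 ?_
  -- The integer `-(n + 1)` has code `2 * n + 1`; truncated subtraction gives the code 0 of 0.
  have : Primrec (fun n : ℕ => 2 * n - 1) := Primrec.nat_sub.comp Primrec.nat_double (Primrec.const 1)
  refine this.of_eq fun n => ?_
  cases n with
  | zero => rfl
  | succ n =>
    change _ = 2 * n + 1
    omega

@[fun_prop]
lemma Primrec.fst_comp {f : α → β × σ} (hf : Primrec f) : Primrec fun a => (f a).1 :=
  Primrec.fst.comp hf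

@[fun_prop]
lemma Primrec.snd_comp {f : α → β × σ} (hf : Primrec f) : Primrec fun a => (f a).2 :=
  Primrec.snd.comp hf

@[fun_prop]
lemma Primrec.add_comp {f g : α → ℕ} (hf : Primrec f) (hg : Primrec g) :
    Primrec fun a => f a + g a := Primrec.nat_add.comp hf hg

@[fun_prop]
lemma Primrec.mul_comp {f g : α → ℕ} (hf : Primrec f) (hg : Primrec g) :
    Primrec fun a => f a * g a := Primrec.nat_mul.comp hf hg

@[fun_prop]
lemma Primrec.sub_comp {f g : α → ℕ} (hf : Primrec f) (hg : Primrec g) :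
    Primrec fun a => f a - g a := Primrec.nat_sub.comp hf hg

@[fun_prop]
lemma Primrec.cons_comp {f : α → β} {g : α → List β} (hf : Primrec f) (hg : Primrec g) :
    Primrec fun a => f a :: g a := Primrec.list_cons.comp hf hg

@[fun_prop]
lemma Primrec.append_comp {f g : α → List β} (hf : Primrec f) (hg : Primrec g) :
    Primrec fun a => f a ++ g a := Primrec.list_append.comp hf hg

lemma PrimrecPred.exists_mem {R : α → β → Prop} {f : α → List β} (hf : Primrec f)
    (hR : PrimrecPred fun x : α × β => R x.1 x.2) : PrimrecPred fun a => ∃ b ∈ f a, R a b := by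
  have : PrimrecRel fun (b : β) (a : α) => R a b := hR.primrecRel.swap
  exact this.exists_mem_list.comp hf Primrec.id

lemma PrimrecPred.forall_mem {R : α → β → Prop} {f : α → List β} (hf : Primrec f)
    (hR : PrimrecPred fun x : α × β => R x.1 x.2) : PrimrecPred fun a => ∀ b ∈ f a, R a b := by
  have : PrimrecRel fun (b : β) (a : α) => R a b := hR.primrecRel.swap
  exact this.forall_mem_list.comp hf Primrec.id

lemma PrimrecPred.exists_nat_lt {R : α → ℕ → Prop} {f : α → ℕ} (hf : Primrec f)
    (hR : PrimrecPred fun x : α × ℕ => R x.1 x.2) : PrimrecPred fun a => ∃ n < f a, R a n :=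
  (PrimrecPred.exists_mem (Primrec.list_range.comp hf) hR).of_eq (by simp)

lemma PrimrecPred.forall_nat_lt {R : α → ℕ → Prop} {f : α → ℕ} (hf : Primrec f)
    (hR : PrimrecPred fun x : α × ℕ => R x.1 x.2) : PrimrecPred fun a => ∀ n < f a, R a n :=
  (PrimrecPred.forall_mem (Primrec.list_range.comp hf) hR).of_eq (by simp)

end Primrec

/-! ### Polynomials as differences of polynomials with natural coefficients -/

/-- A list of monomials with natural coefficients. -/
abbrev NatPoly : Type := List (ℕ × ℕ × ℕ × ℕ)

/-- An integer polynomial, as a difference of two polynomials with natural coefficients. -/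
abbrev DiffPoly : Type := NatPoly × NatPoly

namespace DiffPoly

/-- The integer polynomial that is given by a difference. -/
def toIntPoly (s : DiffPoly) : IntPoly :=
  s.1.map (fun m => ((m.1 : ℤ), m.2)) ++ s.2.map (fun m => (-(m.1 : ℤ), m.2))

/-- The value at `(a, b, r)`. -/
def value (s : DiffPoly) (a b r : ℝ) : ℝ := s.toIntPoly.value a b r

/-- Sum of two differences. -/
def add (s t : DiffPoly) : DiffPoly := (s.1 ++ t.1, s.2 ++ t.2)

/-- Negative of a difference. -/
def neg (s : DiffPoly) : DiffPoly := (s.2, s.1)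

/-- Natural multiple of a difference. -/
def smul (N : ℕ) (s : DiffPoly) : DiffPoly :=
  (s.1.map (fun m => (N * m.1, m.2)), s.2.map (fun m => (N * m.1, m.2)))

/-- With the signs kept apart, all arithmetic of coefficients takes place in `ℕ` and negation is a
swap, which makes primitive recursiveness easy. -/
lemma value_eq (s : DiffPoly) (a b r : ℝ) : s.value a b r =
    (s.1.map fun m => (m.1 : ℝ) * a ^ m.2.1 * b ^ m.2.2.1 * r ^ m.2.2.2).sum -
      (s.2.map fun m => (m.1 : ℝ) * a ^ m.2.1 * b ^ m.2.2.1 * r ^ m.2.2.2).sum := by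
  have hneg : ∀ l : NatPoly, (l.map fun m => (-(m.1 : ℝ)) * a ^ m.2.1 * b ^ m.2.2.1 *
      r ^ m.2.2.2).sum = -(l.map fun m => (m.1 : ℝ) * a ^ m.2.1 * b ^ m.2.2.1 * r ^ m.2.2.2).sum := by
    intro l
    induction l with
    | nil => simp
    | cons m l ih => rw [List.map_cons, List.sum_cons, ih, List.map_cons, List.sum_cons]; ring
  rw [sub_eq_add_neg, ← hneg]
  simp [value, toIntPoly, IntPoly.value, Function.comp_def]

lemma value_add (s t : DiffPoly) (a b r : ℝ) :
    (add s t).value a b r = s.value a b r + t.value a b r := by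
  simp only [value_eq, add, List.map_append, List.sum_append]; ring

lemma value_neg (s : DiffPoly) (a b r : ℝ) : (neg s).value a b r = - s.value a b r := by
  simp only [value_eq, neg]; ring

lemma value_smul (N : ℕ) (s : DiffPoly) (a b r : ℝ) :
    (smul N s).value a b r = N * s.value a b r := by
  simp only [value_eq, smul, List.map_map, mul_sub, ← List.sum_map_mul_left]
  congr 2 <;> · congr 1; ext m; simp; ring

/-- `discForm a b r m n i`. -/
def form (m n i : ℕ) : DiffPoly :=
  ([(i * i, 0, 0, 2), (2 * i * m, 1, 0, 0), (2 * i * n, 0, 1, 0)],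
    [(m * m + n * n, 0, 0, 0), (i * i, 2, 0, 0), (i * i, 0, 2, 0)])

/-- `discPolar a b r m n i m' n' i'`. -/
def polar (m n i m' n' i' : ℕ) : DiffPoly :=
  ([(i * i', 0, 0, 2), (i' * m + i * m', 1, 0, 0), (i' * n + i * n', 0, 1, 0)],
    [(m * m' + n * n', 0, 0, 0), (i * i', 2, 0, 0), (i * i', 0, 2, 0)])

/-- `m * a + n * b`. -/
def lin (m n : ℕ) : DiffPoly := ([(m, 1, 0, 0), (n, 0, 1, 0)], [])

/-- `q * a - p * b`. -/
def det (p q : ℕ) : DiffPoly := ([(q, 1, 0, 0)], [(p, 0, 1, 0)])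

/-- `(q * a - p * b) ^ 2 - r ^ 2 * (p ^ 2 + q ^ 2)`. -/
def support (p q : ℕ) : DiffPoly :=
  ([(q * q, 2, 0, 0), (p * p, 0, 2, 0)], [(2 * p * q, 1, 1, 0), (p * p + q * q, 0, 0, 2)])

/-- `a ^ 2 + b ^ 2 - r ^ 2`. -/
def power : DiffPoly := ([(1, 2, 0, 0), (1, 0, 2, 0)], [(1, 0, 0, 2)])

/-- `a + r`. -/
def aAddR : DiffPoly := ([(1, 1, 0, 0), (1, 0, 0, 1)], [])

/-- `b + r`. -/
def bAddR : DiffPoly := ([(1, 0, 1, 0), (1, 0, 0, 1)], [])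

variable (a b r : ℝ) (m n i m' n' i' p q : ℕ)

lemma value_form : (form m n i).value a b r = discForm a b r m n i := by
  simp [value_eq, form, discForm]; ring

lemma value_polar : (polar m n i m' n' i').value a b r = discPolar a b r m n i m' n' i' := by
  simp [value_eq, polar, discPolar]; ring

lemma value_lin : (lin m n).value a b r = m * a + n * b := by
  simp [value_eq, lin]

lemma value_det : (det p q).value a b r = q * a - p * b := by
  simp [value_eq, det]

lemma value_support :
    (support p q).value a b r = (q * a - p * b) ^ 2 - r ^ 2 * ((p : ℝ) ^ 2 + q ^ 2) := by
  simp [value_eq, support]; ring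

lemma value_power : power.value a b r = a ^ 2 + b ^ 2 - r ^ 2 := by
  simp [value_eq, power]

lemma value_aAddR : aAddR.value a b r = a + r := by simp [value_eq, aAddR]

lemma value_bAddR : bAddR.value a b r = b + r := by simp [value_eq, bAddR]

section

variable {α : Type*} [Primcodable α]

@[fun_prop]
lemma primrec_toIntPoly : Primrec toIntPoly := by
  unfold toIntPoly
  refine Primrec.append_comp (Primrec.list_map Primrec.fst ?_) (Primrec.list_map Primrec.snd ?_)
  · have : Primrec fun x : DiffPoly × (ℕ × ℕ × ℕ × ℕ) => ((x.2.1 : ℤ), x.2.2) :=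
      Primrec.pair (Primrec.int_natCast.comp (by fun_prop)) (by fun_prop)
    exact this.to₂
  · have : Primrec fun x : DiffPoly × (ℕ × ℕ × ℕ × ℕ) => (-(x.2.1 : ℤ), x.2.2) :=
      Primrec.pair (Primrec.int_neg_natCast.comp (by fun_prop)) (by fun_prop)
    exact this.to₂

@[fun_prop]
lemma primrec_add {f g : α → DiffPoly} (hf : Primrec f) (hg : Primrec g) :
    Primrec fun x => add (f x) (g x) := by
  unfold add; fun_prop

@[fun_prop]
lemma primrec_neg {f : α → DiffPoly} (hf : Primrec f) : Primrec fun x => neg (f x) := by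
  unfold neg; fun_prop

@[fun_prop]
lemma primrec_smul {f : α → ℕ} {g : α → DiffPoly} (hf : Primrec f) (hg : Primrec g) :
    Primrec fun x => smul (f x) (g x) := by
  unfold smul
  have : Primrec fun x : α × (ℕ × ℕ × ℕ × ℕ) => (f x.1 * x.2.1, x.2.2) := by fun_prop
  exact Primrec.pair (Primrec.list_map (by fun_prop) this.to₂)
    (Primrec.list_map (by fun_prop) this.to₂)

@[fun_prop]
lemma primrec_form {f g h : α → ℕ} (hf : Primrec f) (hg : Primrec g) (hh : Primrec h) :
    Primrec fun x => form (f x) (g x) (h x) := by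
  unfold form; fun_prop

@[fun_prop]
lemma primrec_polar {f g h f' g' h' : α → ℕ} (hf : Primrec f) (hg : Primrec g) (hh : Primrec h)
    (hf' : Primrec f') (hg' : Primrec g') (hh' : Primrec h') :
    Primrec fun x => polar (f x) (g x) (h x) (f' x) (g' x) (h' x) := by
  unfold polar; fun_prop

@[fun_prop]
lemma primrec_lin {f g : α → ℕ} (hf : Primrec f) (hg : Primrec g) :
    Primrec fun x => lin (f x) (g x) := by
  unfold lin; fun_prop

@[fun_prop]
lemma primrec_det {f g : α → ℕ} (hf : Primrec f) (hg : Primrec g) :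
    Primrec fun x => det (f x) (g x) := by
  unfold det; fun_prop

@[fun_prop]
lemma primrec_support {f g : α → ℕ} (hf : Primrec f) (hg : Primrec g) :
    Primrec fun x => support (f x) (g x) := by
  unfold support; fun_prop

end

end DiffPoly

/-! ### Certificates

A certificate is checked relative to a relation `K`, where `K p c` expresses that the question
whether `p(a, b, r) ≥ 0` is known to have the answer `c`. -/

section Certificates

variable (K : IntPoly → Bool → Prop)

/-- The known sign of a difference of natural polynomials. -/
def KnownSign (s : DiffPoly) (c : Bool) : Prop := K s.toIntPoly c

/-- A certificate for `(m, n)` being in the semigroup. -/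
def CertMem (T m n : ℕ) : Prop := ∃ i < T, KnownSign K (.form m n i) true

/-- A certificate for `(m, n)` not being in the semigroup. -/
def CertNotMem (T m n : ℕ) : Prop :=
  KnownSign K .power true ∧ KnownSign K (.add (.smul T .power) (.neg (.smul 2 (.lin m n)))) true ∧
    ∀ i < T + 1, KnownSign K (.form m n i) false

/-- A certificate for `|a ^ 2 + b ^ 2 - r ^ 2| ≤ N * s`. -/
def CertAbsLe (N : ℕ) (s : DiffPoly) : Prop :=
  KnownSign K (.add (.smul N s) .power) true ∧ KnownSign K (.add (.smul N s) (.neg .power)) true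

/-- A certificate for `EndCondition`, where `d` is the polynomial of the determinant. -/
def CertEnd (d : DiffPoly) (p q i N z : ℕ) : Prop :=
  (KnownSign K d true ∧ KnownSign K (.support p q) true) ∨ (z = 0 ∧ CertAbsLe K N (.form p q i))

/-- A certificate for `IsFrame`. -/
def CertFrame (p q i p' q' i' N : ℕ) : Prop :=
  (0 < N ∧ p * q' < q * p') ∧
  (KnownSign K (.form p q i) true ∧ KnownSign K (.form p' q' i') true) ∧
  CertAbsLe K N (.smul 2 (.polar p q i p' q' i')) ∧
  CertEnd K (.det p q) p q i N p ∧ CertEnd K (.neg (.det p' q')) p' q' i' N q'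

/-- A certificate for the elements of `l` being irreducible elements of the semigroup. -/
def CertIrred (T : ℕ) (l : List (ℕ × ℕ)) : Prop :=
  ∀ g ∈ l, (CertMem K T g.1 g.2 ∧ g ≠ 0) ∧
    ∀ h ∈ l, h = g ∨ ¬ (h.1 ≤ g.1 ∧ h.2 ≤ g.2) ∨ CertNotMem K T (g.1 - h.1) (g.2 - h.2)

/-- A certificate for the elements of the semigroup in a box being generated by `l`. -/
def CertBox (W T : ℕ) (l : List (ℕ × ℕ)) : Prop :=
  ∀ m < W + 1, ∀ n < W + 1, (m = 0 ∧ n = 0) ∨ CertNotMem K T m n ∨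
    ∃ g ∈ l, (g ≠ 0 ∧ g.1 ≤ m ∧ g.2 ≤ n) ∧ CertMem K T (m - g.1) (n - g.2)

/-- A certificate for the disc not meeting the quadrant. -/
def CertEmpty : Prop :=
  KnownSign K .aAddR false ∨ KnownSign K .bAddR false ∨
    (KnownSign K (.lin 1 0) false ∧ KnownSign K (.lin 0 1) false ∧
      KnownSign K (.neg .power) false)

/-- The data of a certificate: two lattice vectors with their heights, the constants of the frame
and of the search for heights, and the list of generators. -/
abbrev CertData : Type := (ℕ × ℕ × ℕ) × (ℕ × ℕ × ℕ) × ℕ × ℕ × List (ℕ × ℕ)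

/-- The list of generators of a certificate. -/
def CertData.gens (c : CertData) : List (ℕ × ℕ) := c.2.2.2.2

/-- The certificate `c` proves that `c.gens` is the minimal generating system. -/
def IsCert (c : CertData) : Prop :=
  (c.gens = [] ∧ CertEmpty K) ∨
    (CertFrame K c.1.1 c.1.2.1 c.1.2.2 c.2.1.1 c.2.1.2.1 c.2.1.2.2 c.2.2.1 ∧
      CertBox K (frameBound c.1.1 c.1.2.1 c.2.1.1 c.2.1.2.1 c.2.2.1) c.2.2.2.1 c.gens ∧
      CertIrred K c.2.2.2.1 c.gens)

end Certificates

/-! Certificates are preserved by the growth of knowledge. -/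

section Eventually

variable {K : IntPoly → Bool → Prop} {ι : Type*} {F : Filter ι} {K' : ι → IntPoly → Bool → Prop}

lemma CertMem.eventually (hK : ∀ p c, K p c → ∀ᶠ x in F, K' x p c) {T m n : ℕ}
    (h : CertMem K T m n) : ∀ᶠ x in F, CertMem (K' x) T m n := by
  obtain ⟨i, hi, h⟩ := h
  exact (hK _ _ h).mono fun x hx => ⟨i, hi, hx⟩

lemma CertNotMem.eventually (hK : ∀ p c, K p c → ∀ᶠ x in F, K' x p c) {T m n : ℕ}
    (h : CertNotMem K T m n) : ∀ᶠ x in F, CertNotMem (K' x) T m n :=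
  (hK _ _ h.1).and ((hK _ _ h.2.1).and
    ((Set.finite_lt_nat (T + 1)).eventually_all.2 fun i hi => hK _ _ (h.2.2 i hi)))

lemma CertAbsLe.eventually (hK : ∀ p c, K p c → ∀ᶠ x in F, K' x p c) {N : ℕ} {s : DiffPoly}
    (h : CertAbsLe K N s) : ∀ᶠ x in F, CertAbsLe (K' x) N s :=
  (hK _ _ h.1).and (hK _ _ h.2)

lemma CertEnd.eventually (hK : ∀ p c, K p c → ∀ᶠ x in F, K' x p c) {d : DiffPoly} {p q i N z : ℕ}
    (h : CertEnd K d p q i N z) : ∀ᶠ x in F, CertEnd (K' x) d p q i N z := by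
  rcases h with ⟨h1, h2⟩ | ⟨h1, h2⟩
  · exact ((hK _ _ h1).and (hK _ _ h2)).mono fun x hx => Or.inl hx
  · exact (h2.eventually hK).mono fun x hx => Or.inr ⟨h1, hx⟩

lemma CertFrame.eventually (hK : ∀ p c, K p c → ∀ᶠ x in F, K' x p c) {p q i p' q' i' N : ℕ}
    (h : CertFrame K p q i p' q' i' N) : ∀ᶠ x in F, CertFrame (K' x) p q i p' q' i' N := by
  obtain ⟨h1, ⟨h2, h3⟩, h4, h5, h6⟩ := h
  exact (((hK _ _ h2).and (hK _ _ h3)).and ((h4.eventually hK).and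
    ((h5.eventually hK).and (h6.eventually hK)))).mono fun x hx => ⟨h1, hx⟩

lemma CertIrred.eventually (hK : ∀ p c, K p c → ∀ᶠ x in F, K' x p c) {T : ℕ} {l : List (ℕ × ℕ)}
    (h : CertIrred K T l) : ∀ᶠ x in F, CertIrred (K' x) T l := by
  refine (List.finite_toSet l).eventually_all.2 fun g hg => ?_
  obtain ⟨⟨h1, h2⟩, h3⟩ := h g hg
  refine ((h1.eventually hK).mono fun x hx => ⟨hx, h2⟩).and ?_
  refine (List.finite_toSet l).eventually_all.2 fun k hk => ?_
  rcases h3 k hk with h4 | h4 | h4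
  · exact Filter.Eventually.of_forall fun x => Or.inl h4
  · exact Filter.Eventually.of_forall fun x => Or.inr (Or.inl h4)
  · exact (h4.eventually hK).mono fun x hx => Or.inr (Or.inr hx)

lemma CertBox.eventually (hK : ∀ p c, K p c → ∀ᶠ x in F, K' x p c) {W T : ℕ} {l : List (ℕ × ℕ)}
    (h : CertBox K W T l) : ∀ᶠ x in F, CertBox (K' x) W T l := by
  refine (Set.finite_lt_nat (W + 1)).eventually_all.2 fun m hm => ?_
  refine (Set.finite_lt_nat (W + 1)).eventually_all.2 fun n hn => ?_
  rcases h m hm n hn with h1 | h1 | ⟨g, hg, h1, h2⟩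
  · exact Filter.Eventually.of_forall fun x => Or.inl h1
  · exact (h1.eventually hK).mono fun x hx => Or.inr (Or.inl hx)
  · exact (h2.eventually hK).mono fun x hx => Or.inr (Or.inr ⟨g, hg, h1, hx⟩)

lemma CertEmpty.eventually (hK : ∀ p c, K p c → ∀ᶠ x in F, K' x p c) (h : CertEmpty K) :
    ∀ᶠ x in F, CertEmpty (K' x) := by
  rcases h with h | h | ⟨h1, h2, h3⟩
  · exact (hK _ _ h).mono fun x hx => Or.inl hx
  · exact (hK _ _ h).mono fun x hx => Or.inr (Or.inl hx)
  · exact ((hK _ _ h1).and ((hK _ _ h2).and (hK _ _ h3))).mono fun x hx => Or.inr (Or.inr hx)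

/-- A certificate rests on finitely many answers, and finitely many eventual facts eventually hold
together. Along `atTop` this says that a true certificate is verified in the end; a `pure` filter
gives monotonicity. -/
lemma IsCert.eventually (hK : ∀ p c, K p c → ∀ᶠ x in F, K' x p c) {c : CertData}
    (h : IsCert K c) : ∀ᶠ x in F, IsCert (K' x) c := by
  rcases h with ⟨h1, h2⟩ | ⟨h1, h2, h3⟩
  · exact (h2.eventually hK).mono fun x hx => Or.inl ⟨h1, hx⟩
  · exact ((h1.eventually hK).and ((h2.eventually hK).and (h3.eventually hK))).mono
      fun x hx => Or.inr hx

lemma IsCert.mono {K' : IntPoly → Bool → Prop} (hK : ∀ p c, K p c → K' p c) {c : CertData}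
    (h : IsCert K c) : IsCert K' c :=
  Filter.eventually_pure.1 (h.eventually (F := pure ()) (K' := fun _ => K')
    fun p c h => Filter.eventually_pure.2 (hK p c h))

end Eventually

/-! Checking certificates against a list of answers is primitive recursive. -/

/-- The answer to the question number `encode p` in the list `h` of answers, latest answer first. -/
def KnownFrom (h : List Bool) (p : IntPoly) (c : Bool) : Prop :=
  h.reverse[Encodable.encode p]? = some c

section Primrec

variable {α : Type*} [Primcodable α]

lemma primrecPred_knownSign {f : α → List Bool} {s : α → DiffPoly} {c : Bool} (hf : Primrec f)
    (hs : Primrec s) : PrimrecPred fun x => KnownSign (KnownFrom (f x)) (s x) c := by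
  unfold KnownSign KnownFrom
  exact Primrec.eq.comp (Primrec.list_getElem?.comp (Primrec.list_reverse.comp hf)
    (Primrec.encode.comp (DiffPoly.primrec_toIntPoly.comp hs))) (Primrec.const _)

lemma primrecPred_certMem {f : α → List Bool} {T m n : α → ℕ} (hf : Primrec f) (hT : Primrec T)
    (hm : Primrec m) (hn : Primrec n) :
    PrimrecPred fun x => CertMem (KnownFrom (f x)) (T x) (m x) (n x) :=
  PrimrecPred.exists_nat_lt hT (primrecPred_knownSign (by fun_prop) (by fun_prop))

lemma primrecPred_certNotMem {f : α → List Bool} {T m n : α → ℕ} (hf : Primrec f) (hT : Primrec T)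
    (hm : Primrec m) (hn : Primrec n) :
    PrimrecPred fun x => CertNotMem (KnownFrom (f x)) (T x) (m x) (n x) :=
  (primrecPred_knownSign hf (by fun_prop)).and ((primrecPred_knownSign hf (by fun_prop)).and
    (PrimrecPred.forall_nat_lt (by fun_prop) (primrecPred_knownSign (by fun_prop) (by fun_prop))))

lemma primrecPred_certAbsLe {f : α → List Bool} {N : α → ℕ} {s : α → DiffPoly} (hf : Primrec f)
    (hN : Primrec N) (hs : Primrec s) :
    PrimrecPred fun x => CertAbsLe (KnownFrom (f x)) (N x) (s x) :=
  (primrecPred_knownSign hf (by fun_prop)).and (primrecPred_knownSign hf (by fun_prop))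

lemma primrecPred_certEnd {f : α → List Bool} {d : α → DiffPoly} {p q i N z : α → ℕ}
    (hf : Primrec f) (hd : Primrec d) (hp : Primrec p) (hq : Primrec q) (hi : Primrec i)
    (hN : Primrec N) (hz : Primrec z) :
    PrimrecPred fun x => CertEnd (KnownFrom (f x)) (d x) (p x) (q x) (i x) (N x) (z x) :=
  ((primrecPred_knownSign hf hd).and (primrecPred_knownSign hf (by fun_prop))).or
    ((Primrec.eq.comp hz (Primrec.const 0)).and (primrecPred_certAbsLe hf hN (by fun_prop)))

lemma primrecPred_certFrame {f : α → List Bool} {p q i p' q' i' N : α → ℕ} (hf : Primrec f)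
    (hp : Primrec p) (hq : Primrec q) (hi : Primrec i) (hp' : Primrec p') (hq' : Primrec q')
    (hi' : Primrec i') (hN : Primrec N) :
    PrimrecPred fun x =>
      CertFrame (KnownFrom (f x)) (p x) (q x) (i x) (p' x) (q' x) (i' x) (N x) :=
  ((Primrec.nat_lt.comp (Primrec.const 0) hN).and
      (Primrec.nat_lt.comp (by fun_prop) (by fun_prop))).and
    (((primrecPred_knownSign hf (by fun_prop)).and (primrecPred_knownSign hf (by fun_prop))).and
      ((primrecPred_certAbsLe hf hN (by fun_prop)).and
        ((primrecPred_certEnd hf (by fun_prop) hp hq hi hN hp).and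
          (primrecPred_certEnd hf (by fun_prop) hp' hq' hi' hN hq'))))

lemma primrecPred_certIrred {f : α → List Bool} {T : α → ℕ} {l : α → List (ℕ × ℕ)}
    (hf : Primrec f) (hT : Primrec T) (hl : Primrec l) :
    PrimrecPred fun x => CertIrred (KnownFrom (f x)) (T x) (l x) := by
  refine PrimrecPred.forall_mem hl (((primrecPred_certMem (by fun_prop) (by fun_prop) (by fun_prop)
    (by fun_prop)).and (Primrec.eq.comp (by fun_prop) (Primrec.const 0)).not).and ?_)
  refine PrimrecPred.forall_mem (by fun_prop) ((Primrec.eq.comp (by fun_prop) (by fun_prop)).or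
    (((Primrec.nat_le.comp ?_ ?_).and (Primrec.nat_le.comp ?_ ?_)).not.or
    (primrecPred_certNotMem (by fun_prop) (by fun_prop) (by fun_prop) (by fun_prop)))) <;> fun_prop

lemma primrecPred_certBox {f : α → List Bool} {W T : α → ℕ} {l : α → List (ℕ × ℕ)}
    (hf : Primrec f) (hW : Primrec W) (hT : Primrec T) (hl : Primrec l) :
    PrimrecPred fun x => CertBox (KnownFrom (f x)) (W x) (T x) (l x) := by
  refine PrimrecPred.forall_nat_lt (by fun_prop) (PrimrecPred.forall_nat_lt (by fun_prop)
    (((Primrec.eq.comp ?_ (Primrec.const 0)).and (Primrec.eq.comp ?_ (Primrec.const 0))).or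
      ((primrecPred_certNotMem ?_ ?_ ?_ ?_).or (PrimrecPred.exists_mem ?_
      (((Primrec.eq.comp ?_ (Primrec.const 0)).not.and ((Primrec.nat_le.comp ?_ ?_).and
      (Primrec.nat_le.comp ?_ ?_))).and (primrecPred_certMem ?_ ?_ ?_ ?_)))))) <;> fun_prop

lemma primrecPred_certEmpty {f : α → List Bool} (hf : Primrec f) :
    PrimrecPred fun x => CertEmpty (KnownFrom (f x)) :=
  (primrecPred_knownSign hf (by fun_prop)).or ((primrecPred_knownSign hf (by fun_prop)).or
    ((primrecPred_knownSign hf (by fun_prop)).and ((primrecPred_knownSign hf (by fun_prop)).and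
      (primrecPred_knownSign hf (by fun_prop)))))

@[fun_prop]
lemma primrec_gens {c : α → CertData} (hc : Primrec c) : Primrec fun x => (c x).gens := by
  unfold CertData.gens; fun_prop

lemma primrecPred_isCert {f : α → List Bool} {c : α → CertData} (hf : Primrec f)
    (hc : Primrec c) : PrimrecPred fun x => IsCert (KnownFrom (f x)) (c x) := by
  refine ((Primrec.eq.comp (by fun_prop) (Primrec.const [])).and (primrecPred_certEmpty hf)).or
    ((primrecPred_certFrame ?_ ?_ ?_ ?_ ?_ ?_ ?_ ?_).and ((primrecPred_certBox ?_ ?_ ?_ ?_).and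
      (primrecPred_certIrred ?_ ?_ ?_))) <;> try fun_prop
  unfold frameBound
  simp only [pow_two]
  fun_prop

end Primrec

/-! ### True certificates -/

/-- The true answers to the questions on `(a, b, r)`. -/
def TrueAnswer (a b r : ℝ) (p : IntPoly) (c : Bool) : Prop := p.answer a b r = c

section True

variable {a b r : ℝ}

lemma knownSign_true {s : DiffPoly} : KnownSign (TrueAnswer a b r) s true ↔ 0 ≤ s.value a b r := by
  simp [KnownSign, TrueAnswer, IntPoly.answer, DiffPoly.value]

lemma knownSign_false {s : DiffPoly} :
    KnownSign (TrueAnswer a b r) s false ↔ s.value a b r < 0 := by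
  simp [KnownSign, TrueAnswer, IntPoly.answer, DiffPoly.value]

lemma certMem_true {T m n : ℕ} :
    CertMem (TrueAnswer a b r) T m n ↔ ∃ i < T, 0 ≤ discForm a b r m n (i : ℕ) := by
  simp [CertMem, knownSign_true, DiffPoly.value_form]

lemma certNotMem_true {T m n : ℕ} :
    CertNotMem (TrueAnswer a b r) T m n ↔ 0 ≤ a ^ 2 + b ^ 2 - r ^ 2 ∧
      2 * (m * a + n * b) ≤ T * (a ^ 2 + b ^ 2 - r ^ 2) ∧
        ∀ i < T + 1, discForm a b r m n (i : ℕ) < 0 := by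
  simp only [CertNotMem, knownSign_true, knownSign_false, DiffPoly.value_form, DiffPoly.value_power,
    DiffPoly.value_add, DiffPoly.value_smul, DiffPoly.value_neg, DiffPoly.value_lin, Nat.cast_ofNat,
    ← sub_eq_add_neg, sub_nonneg]

lemma CertMem.mem (hr : 0 < r) {T m n : ℕ} (h : CertMem (TrueAnswer a b r) T m n) :
    (m, n) ∈ discSemigroup a b r hr := by
  obtain ⟨i, -, hi⟩ := certMem_true.1 h
  exact (mem_discSemigroup_iff hr).2 ⟨i, hi⟩

/-- From height `T` on the form is at most its value at height 0, which is among the values checked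
to be negative. -/
lemma CertNotMem.notMem (hr : 0 < r) {T m n : ℕ} (h : CertNotMem (TrueAnswer a b r) T m n) :
    (m, n) ∉ discSemigroup a b r hr := by
  obtain ⟨hk, hT, h⟩ := certNotMem_true.1 h
  rw [mem_discSemigroup_iff]
  rintro ⟨i, hi⟩
  rcases lt_or_ge i (T + 1) with hlt | hge
  · exact absurd hi (not_le.2 (h i hlt))
  · have hi' : (T : ℝ) ≤ i := by exact_mod_cast (by omega : T ≤ i)
    have h0 := h 0 (by omega)
    rw [discForm_expand] at h0 hi
    simp only [Nat.cast_zero, zero_mul, zero_sub] at h0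
    have h1 : (2 * (m * a + n * b) - (a ^ 2 + b ^ 2 - r ^ 2) * i : ℝ) ≤ 0 := by nlinarith
    have h2 := mul_nonpos_of_nonneg_of_nonpos (Nat.cast_nonneg (α := ℝ) i) h1
    linarith

lemma eventually_certMem (hr : 0 < r) {n : ℕ × ℕ} (h : n ∈ discSemigroup a b r hr) :
    ∀ᶠ T in Filter.atTop, CertMem (TrueAnswer a b r) T n.1 n.2 := by
  obtain ⟨i, hi⟩ := (mem_discSemigroup_iff hr).1 h
  filter_upwards [Filter.eventually_gt_atTop i] with T hT
  exact certMem_true.2 ⟨i, hT, hi⟩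

lemma eventually_certNotMem (hr : 0 < r) (hk : 0 < a ^ 2 + b ^ 2 - r ^ 2) {n : ℕ × ℕ}
    (h : n ∉ discSemigroup a b r hr) :
    ∀ᶠ T in Filter.atTop, CertNotMem (TrueAnswer a b r) T n.1 n.2 := by
  rw [mem_discSemigroup_iff] at h
  push Not at h
  filter_upwards [Filter.eventually_ge_atTop
    ⌈2 * (n.1 * a + n.2 * b) / (a ^ 2 + b ^ 2 - r ^ 2)⌉₊] with T hT
  refine certNotMem_true.2 ⟨hk.le, ?_, fun i _ => h i⟩
  rw [← div_le_iff₀ hk]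
  exact Nat.ceil_le.1 hT

lemma certAbsLe_true {N : ℕ} {s : DiffPoly} : CertAbsLe (TrueAnswer a b r) N s ↔
    |a ^ 2 + b ^ 2 - r ^ 2| ≤ N * s.value a b r := by
  simp only [CertAbsLe, knownSign_true, DiffPoly.value_power, DiffPoly.value_add,
    DiffPoly.value_smul, DiffPoly.value_neg]
  rw [abs_le]
  constructor <;> rintro ⟨h1, h2⟩ <;> constructor <;> linarith

lemma certFrame_true {p q i p' q' i' N : ℕ} : CertFrame (TrueAnswer a b r) p q i p' q' i' N ↔
    IsFrame a b r p q i p' q' i' N := by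
  have hk : b ^ 2 + a ^ 2 - r ^ 2 = a ^ 2 + b ^ 2 - r ^ 2 := by ring
  have h1 : CertEnd (TrueAnswer a b r) (.det p q) p q i N p ↔ EndCondition a b r p q i N := by
    simp only [CertEnd, EndCondition, knownSign_true, certAbsLe_true, DiffPoly.value_det,
      DiffPoly.value_support, DiffPoly.value_form, sub_nonneg]
  -- Reflection in the diagonal preserves `support` and `form`, changes the sign of the determinant,
  -- and makes `q'` the coordinate that has to vanish.
  have h2 : CertEnd (TrueAnswer a b r) (.neg (.det p' q')) p' q' i' N q' ↔
      EndCondition b a r q' p' i' N := by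
    simp only [CertEnd, EndCondition, knownSign_true, certAbsLe_true, DiffPoly.value_det,
      DiffPoly.value_support, DiffPoly.value_form, DiffPoly.value_neg, sub_nonneg, neg_sub,
      discForm_swap a b, hk, add_comm ((q' : ℝ) ^ 2), sub_sq_comm ((p' : ℝ) * b)]
  simp only [CertFrame, h1, h2, knownSign_true, certAbsLe_true, DiffPoly.value_smul,
    DiffPoly.value_form, DiffPoly.value_polar, Nat.cast_ofNat]
  constructor
  · rintro ⟨⟨h1, h2⟩, ⟨h3, h4⟩, h5, h6, h7⟩
    exact ⟨h1, h2, h3, h4, h5, h6, h7⟩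
  · rintro ⟨h1, h2, h3, h4, h5, h6, h7⟩
    exact ⟨⟨h1, h2⟩, ⟨h3, h4⟩, h5, h6, h7⟩

lemma CertEmpty.eq_bot (hr : 0 < r) (h : CertEmpty (TrueAnswer a b r)) :
    discSemigroup a b r hr = ⊥ := by
  apply discSemigroup_eq_bot hr
  rw [Set.eq_empty_iff_forall_notMem]
  rintro X ⟨hX, hX0, hX1⟩
  rw [mem_disc_iff hr.le] at hX
  simp only [CertEmpty, knownSign_false, DiffPoly.value_aAddR, DiffPoly.value_bAddR,
    DiffPoly.value_lin, DiffPoly.value_neg, DiffPoly.value_power, Nat.cast_one, Nat.cast_zero,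
    one_mul, zero_mul, add_zero, zero_add] at h
  rcases h with h | h | ⟨h1, h2, h3⟩
  · unfold discForm at hX
    nlinarith [sq_nonneg (X 1 - 1 * b)]
  · unfold discForm at hX
    nlinarith [sq_nonneg (X 0 - 1 * a)]
  · rw [discForm_expand] at hX
    nlinarith

/-- If all three alternatives fail, the point of the quadrant nearest to the center lies in the
disc. -/
lemma certEmpty_of_eq_empty (hr : 0 < r) (h : disc a b r ∩ quadrant = ∅) :
    CertEmpty (TrueAnswer a b r) := by
  have H : ∀ u v : ℝ, 0 ≤ u → 0 ≤ v → discForm a b r u v 1 < 0 := by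
    intro u v hu hv
    by_contra! hF
    have : (!₂[u, v] : Plane) ∈ disc a b r ∩ quadrant :=
      ⟨(mem_disc_iff hr.le).2 (by simpa using hF), by simpa using hu, by simpa using hv⟩
    rw [h] at this
    exact this
  simp only [CertEmpty, knownSign_false, DiffPoly.value_aAddR, DiffPoly.value_bAddR,
    DiffPoly.value_lin, DiffPoly.value_neg, DiffPoly.value_power, Nat.cast_one, Nat.cast_zero,
    one_mul, zero_mul, add_zero, zero_add]
  by_contra! hcon
  obtain ⟨h1, h2, h3⟩ := hcon
  rcases lt_or_ge a 0 with ha | ha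
  · rcases lt_or_ge b 0 with hb | hb
    · have := H 0 0 le_rfl le_rfl
      have := h3 ha hb
      unfold discForm at *
      nlinarith
    · have := H 0 b le_rfl hb
      unfold discForm at this
      nlinarith
  · have := H a (max b 0) ha (le_max_right _ _)
    unfold discForm at this
    rcases max_cases b 0 with ⟨e, _⟩ | ⟨e, _⟩ <;> rw [e] at this <;> nlinarith

end True

/-! ### Minimal generating systems -/

lemma exists_add_of_mem_closure {B : Set (ℕ × ℕ)} {n : ℕ × ℕ} (hn : n ∈ AddSubmonoid.closure B)
    (h0 : n ≠ 0) : ∃ g ∈ B, g ≠ 0 ∧ ∃ m ∈ AddSubmonoid.closure B, n = g + m := by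
  revert h0
  refine AddSubmonoid.closure_induction_left (motive := fun n _ => n ≠ 0 →
    ∃ g ∈ B, g ≠ 0 ∧ ∃ m ∈ AddSubmonoid.closure B, n = g + m) (fun h => absurd rfl h) ?_ hn
  intro g hg m hm ih h0
  rcases eq_or_ne g 0 with rfl | hg0
  · rw [zero_add] at h0 ⊢
    exact ih h0
  · exact ⟨g, hg, hg0, m, hm, rfl⟩

/-- A sum in which `g` occurs dominates `g`, since there are no negative elements. -/
lemma mem_closure_diff_or {B : Set (ℕ × ℕ)} {n g : ℕ × ℕ} (hn : n ∈ AddSubmonoid.closure B) :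
    n ∈ AddSubmonoid.closure (B \ {g}) ∨ g ≤ n := by
  refine AddSubmonoid.closure_induction (motive := fun n _ =>
    n ∈ AddSubmonoid.closure (B \ {g}) ∨ g ≤ n) ?_ (Or.inl (zero_mem _)) ?_ hn
  · intro n hn
    rcases eq_or_ne n g with rfl | h
    · exact Or.inr le_rfl
    · exact Or.inl (AddSubmonoid.subset_closure ⟨hn, h⟩)
  · rintro m n - - (h1 | h1) h2
    · rcases h2 with h2 | h2
      · exact Or.inl (add_mem h1 h2)
      · exact Or.inr (h2.trans le_add_self)
    · exact Or.inr (h1.trans le_self_add)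

/-- A finitely generated submonoid of `ℕ²` is generated by finitely many irreducible elements. -/
lemma exists_irreducible_generators {S : AddSubmonoid (ℕ × ℕ)} (h : S.FG) :
    ∃ l : List (ℕ × ℕ), AddSubmonoid.closure {n | n ∈ l} = S ∧ ∀ g ∈ l, g ≠ 0 ∧
      ∀ k ∈ l, k ≠ g → ∀ s ∈ S, g ≠ k + s := by
  obtain ⟨G₀, hG₀⟩ := h
  obtain ⟨G, hG, hmin⟩ : ∃ G : Finset (ℕ × ℕ), AddSubmonoid.closure (G : Set (ℕ × ℕ)) = S ∧
      ∀ G' : Finset (ℕ × ℕ), AddSubmonoid.closure (G' : Set (ℕ × ℕ)) = S → G.card ≤ G'.card := by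
    obtain ⟨G, h1, h2⟩ := WellFounded.has_min (InvImage.wf (Finset.card (α := ℕ × ℕ)) Nat.lt_wfRel.wf)
      {G | AddSubmonoid.closure (G : Set (ℕ × ℕ)) = S} ⟨G₀, hG₀⟩
    exact ⟨G, h1, fun G' h' => not_lt.1 (h2 G' h')⟩
  have key : ∀ g ∈ G, g ∉ AddSubmonoid.closure ((G : Set (ℕ × ℕ)) \ {g}) := by
    intro g hg hcl
    have h1 : AddSubmonoid.closure ((G.erase g : Finset (ℕ × ℕ)) : Set (ℕ × ℕ)) = S := by
      rw [Finset.coe_erase]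
      refine le_antisymm (hG ▸ AddSubmonoid.closure_mono Set.sdiff_subset) ?_
      rw [← hG, AddSubmonoid.closure_le]
      intro k hk
      rcases eq_or_ne k g with rfl | hne
      · exact hcl
      · exact AddSubmonoid.subset_closure ⟨hk, hne⟩
    have h2 := hmin _ h1
    rw [Finset.card_erase_of_mem hg] at h2
    have := Finset.card_pos.2 ⟨g, hg⟩
    omega
  have hset : {n | n ∈ G.toList} = (G : Set (ℕ × ℕ)) := by ext; simp
  refine ⟨G.toList, by rw [hset, hG], ?_⟩
  simp only [Finset.mem_toList]
  intro g hg
  refine ⟨fun h0 => key g hg (h0 ▸ zero_mem _), ?_⟩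
  rintro k hk hne s hs rfl
  have hk0 : k ≠ 0 := fun h0 => key k hk (h0 ▸ zero_mem _)
  rw [← hG] at hs
  -- If `s` can be generated without `g = k + s`, then so can `g`, against minimality; if `g ≤ s`,
  -- then `k = 0`.
  rcases mem_closure_diff_or (g := k + s) hs with h1 | h1
  · exact key _ hg (add_mem (AddSubmonoid.subset_closure ⟨hk, hne⟩) h1)
  · apply hk0
    have h2 := h1.1; have h3 := h1.2
    simp only [Prod.fst_add, Prod.snd_add] at h2 h3
    exact Prod.ext (by simp; omega) (by simp; omega)

/-- Generation follows by descent along the frame. For minimality, a generator `g` missing from `B'`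
would split off some `k ∈ B'`, but the certificate excludes `g - k` from the semigroup. -/
lemma IsCert.isMinimalGeneratingSystem {a b r : ℝ} (hr : 0 < r) {c : CertData}
    (h : IsCert (TrueAnswer a b r) c) :
    IsMinimalGeneratingSystem {n | n ∈ c.gens} (discSemigroup a b r hr) := by
  rcases h with ⟨h1, h2⟩ | ⟨h1, h2, h3⟩
  · rw [h2.eq_bot hr, h1]
    simp only [List.not_mem_nil, Set.ofPred_false]
    exact ⟨AddSubmonoid.closure_empty, fun B' hB' => absurd (Set.empty_subset B') hB'.2⟩
  · have hcl : AddSubmonoid.closure {n | n ∈ c.gens} = discSemigroup a b r hr := by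
      refine le_antisymm (AddSubmonoid.closure_le.2 fun g hg => (h3 g hg).1.1.mem hr) ?_
      refine (certFrame_true.1 h1).discSemigroup_le hr fun n hn h0 hn1 hn2 => ?_
      rcases h2 n.1 (by omega) n.2 (by omega) with h4 | h4 | ⟨g, hg, ⟨hg0, hg1, hg2⟩, hmem⟩
      · exact absurd (Prod.ext h4.1 h4.2) h0
      · exact absurd hn (h4.notMem hr)
      · exact ⟨g, AddSubmonoid.subset_closure hg, hg0, _, hmem.mem hr,
          Prod.ext (by simp; omega) (by simp; omega)⟩
    refine ⟨hcl, fun B' hB' hcl' => ?_⟩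
    obtain ⟨g, hg, hgB⟩ := Set.exists_of_ssubset hB'
    obtain ⟨⟨hgm, hg0⟩, hirr⟩ := h3 g hg
    have hgS : g ∈ AddSubmonoid.closure B' := hcl' ▸ hgm.mem hr
    obtain ⟨k, hk, -, s, hs, rfl⟩ := exists_add_of_mem_closure hgS hg0
    rcases hirr k (hB'.1 hk) with h4 | h4 | h4
    · exact hgB (h4 ▸ hk)
    · exact h4 ⟨by simp, by simp⟩
    · apply h4.notMem hr
      rw [hcl'] at hs
      simpa using hs

/-- Each of the finitely many facts needed is certified for all large `T`. By `mem_of_nonpos` points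
outside the semigroup exist only if `a ^ 2 + b ^ 2 - r ^ 2 > 0`, where non-membership can be
certified. -/
lemma exists_isCert {a b r : ℝ} (hr : 0 < r)
    (h : disc a b r ∩ quadrant = ∅ ∨ ∃ τ₁ τ₂ : Submodule ℝ Plane, AreExtremalRays a b r τ₁ τ₂)
    (hfg : (discSemigroup a b r hr).FG) : ∃ c, IsCert (TrueAnswer a b r) c := by
  rcases h with h | ⟨τ₁, τ₂, h⟩
  · exact ⟨((0, 0, 0), (0, 0, 0), 0, 0, []), Or.inl ⟨rfl, certEmpty_of_eq_empty hr h⟩⟩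
  obtain ⟨x, y, x', y', hray, -, -⟩ := h.exists_isRayPair hr
  obtain ⟨u, v, hF, huv⟩ := hray.exists_rat_left hr hfg
  obtain ⟨u', v', hF', huv'⟩ := hray.exists_rat_right hr hfg
  obtain ⟨p, q, i, p', q', i', N, hframe, -, -⟩ := hray.exists_isFrame hr hF huv hF' huv'
  obtain ⟨l, hl, hirr⟩ := exists_irreducible_generators hfg
  have hnot : ∀ n ∉ discSemigroup a b r hr,
      ∀ᶠ T in Filter.atTop, CertNotMem (TrueAnswer a b r) T n.1 n.2 := fun n hn =>
    eventually_certNotMem hr (not_le.1 fun hk => hn (hray.mem_of_nonpos hr hk n)) hn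
  have hbox : ∀ᶠ T in Filter.atTop,
      CertBox (TrueAnswer a b r) (frameBound p q p' q' N) T l := by
    refine (Set.finite_lt_nat _).eventually_all.2 fun m hm => ?_
    refine (Set.finite_lt_nat _).eventually_all.2 fun n hn => ?_
    by_cases hmn : (m, n) ∈ discSemigroup a b r hr
    · rcases eq_or_ne ((m, n) : ℕ × ℕ) 0 with h0 | h0
      · simp only [Prod.mk_eq_zero] at h0
        exact Filter.Eventually.of_forall fun T => Or.inl h0
      · rw [← hl] at hmn
        obtain ⟨g, hg, hg0, s, hs, e⟩ := exists_add_of_mem_closure hmn h0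
        rw [hl] at hs
        have e1 : m = g.1 + s.1 := congrArg Prod.fst e
        have e2 : n = g.2 + s.2 := congrArg Prod.snd e
        refine (eventually_certMem hr hs).mono fun T hT => Or.inr (Or.inr ⟨g, hg, ⟨hg0, ?_, ?_⟩, ?_⟩)
        · omega
        · omega
        · rwa [e1, e2, Nat.add_sub_cancel_left, Nat.add_sub_cancel_left]
    · exact (hnot _ hmn).mono fun T hT => Or.inr (Or.inl hT)
  have hir : ∀ᶠ T in Filter.atTop, CertIrred (TrueAnswer a b r) T l := by
    refine (List.finite_toSet l).eventually_all.2 fun g hg => ?_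
    have hgS : g ∈ discSemigroup a b r hr := hl ▸ AddSubmonoid.subset_closure hg
    refine ((eventually_certMem hr hgS).mono fun T hT => ⟨hT, (hirr g hg).1⟩).and ?_
    refine (List.finite_toSet l).eventually_all.2 fun k hk => ?_
    rcases eq_or_ne k g with h1 | h1
    · exact Filter.Eventually.of_forall fun T => Or.inl h1
    by_cases h2 : k.1 ≤ g.1 ∧ k.2 ≤ g.2
    · refine (hnot (g.1 - k.1, g.2 - k.2) fun hs => ?_).mono fun T hT => Or.inr (Or.inr hT)
      exact (hirr g hg).2 k hk h1 _ hs (Prod.ext (by simp; omega) (by simp; omega))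
    · exact Filter.Eventually.of_forall fun T => Or.inr (Or.inl h2)
  obtain ⟨T, h1, h2⟩ := (hbox.and hir).exists
  exact ⟨((p, q, i), (p', q', i'), N, T, l), Or.inr ⟨certFrame_true.2 hframe, h1, h2⟩⟩

/-! ### The procedure -/

/-- The question that is asked at stage `m`. -/
def stageQuestion (m : ℕ) : IntPoly := (Encodable.decode m).getD []

/-- The certificate that is checked at stage `m`. -/
def stageCert (m : ℕ) : CertData :=
  (Encodable.decode m.unpair.1).getD ((0, 0, 0), (0, 0, 0), 0, 0, [])

open Classical in
/-- The procedure asks all questions, and searches for a certificate meanwhile. -/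
noncomputable def certProcedure : Procedure := fun h =>
  if IsCert (KnownFrom h) (stageCert h.length) then Sum.inr (stageCert h.length).gens
  else Sum.inl (stageQuestion h.length)

lemma primrec_stageCert : Primrec stageCert :=
  Primrec.option_getD.comp (Primrec.decode.comp (Primrec.fst.comp Primrec.unpair)) (Primrec.const _)

lemma primrec_stageQuestion : Primrec stageQuestion :=
  Primrec.option_getD.comp Primrec.decode (Primrec.const _)

lemma computable_certProcedure : Computable certProcedure := by
  have h1 : Primrec fun h : List Bool => stageCert h.length :=
    primrec_stageCert.comp Primrec.list_length
  classical
  refine (Primrec.ite (primrecPred_isCert (f := fun h => h) Primrec.id h1) (Primrec.sumInr.comp (primrec_gens h1))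
    (Primrec.sumInl.comp (primrec_stageQuestion.comp Primrec.list_length))).to_comp

/-- The answers to the first `m` questions. -/
noncomputable def stageAnswers (a b r : ℝ) : ℕ → List Bool
  | 0 => []
  | m + 1 => (stageQuestion m).answer a b r :: stageAnswers a b r m

lemma length_stageAnswers (a b r : ℝ) (m : ℕ) : (stageAnswers a b r m).length = m := by
  induction m with
  | zero => rfl
  | succ m ih => rw [stageAnswers, List.length_cons, ih]

lemma reverse_stageAnswers_getElem? (a b r : ℝ) (m j : ℕ) :
    (stageAnswers a b r m).reverse[j]? =
      if j < m then some ((stageQuestion j).answer a b r) else none := by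
  induction m with
  | zero => simp [stageAnswers]
  | succ m ih =>
    rw [stageAnswers, List.reverse_cons]
    rcases lt_trichotomy j m with h | rfl | h
    · rw [List.getElem?_append_left (by simpa [length_stageAnswers] using h), ih, if_pos h,
        if_pos (by omega)]
    · rw [List.getElem?_append_right (by simp [length_stageAnswers])]
      simp [length_stageAnswers]
    · rw [if_neg (by omega), List.getElem?_eq_none]
      simp [length_stageAnswers]; omega

/-- The polynomial `p` is asked at stage `encode p`; the default question at stages that decode to
nothing only keeps the numbering. -/
lemma knownFrom_stageAnswers {a b r : ℝ} {m : ℕ} {p : IntPoly} {c : Bool} :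
    KnownFrom (stageAnswers a b r m) p c ↔ Encodable.encode p < m ∧ TrueAnswer a b r p c := by
  rw [KnownFrom, reverse_stageAnswers_getElem?, stageQuestion, Encodable.encodek, TrueAnswer]
  split_ifs with h <;> simp [h]

lemma certProcedure_outputs {a b r : ℝ} {c : CertData} (hc : IsCert (TrueAnswer a b r) c) :
    ∃ c', IsCert (TrueAnswer a b r) c' ∧ certProcedure.Outputs a b r c'.gens := by
  classical
  have hex : ∃ m, IsCert (KnownFrom (stageAnswers a b r m)) (stageCert m) := by
    have hev : ∀ᶠ m in Filter.atTop, IsCert (KnownFrom (stageAnswers a b r m)) c :=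
      hc.eventually (K' := fun m => KnownFrom (stageAnswers a b r m)) fun p d hp => (Filter.eventually_gt_atTop (Encodable.encode p)).mono
        fun m hm => knownFrom_stageAnswers.2 ⟨hm, hp⟩
    obtain ⟨t, ht⟩ := Filter.eventually_atTop.1 hev
    -- Each certificate returns at infinitely many stages. This one is not before `t`, when all
    -- answers that `c` needs are known.
    refine ⟨Nat.pair (Encodable.encode c) t, ?_⟩
    have : stageCert (Nat.pair (Encodable.encode c) t) = c := by
      rw [stageCert, Nat.unpair_pair, Encodable.encodek, Option.getD_some]
    rw [this]
    exact ht _ (Nat.right_le_pair _ _)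
  have hreach : ∀ m ≤ Nat.find hex, certProcedure.Reaches a b r (stageAnswers a b r m) := by
    intro m
    induction m with
    | zero => exact fun _ => .start
    | succ m ih =>
      intro hm
      refine .ask _ (stageQuestion m) (ih (by omega)) ?_
      rw [certProcedure, length_stageAnswers, if_neg (Nat.find_min hex (by omega))]
  -- The first success may concern a certificate other than `c`; it is still true, because the
  -- recorded answers are.
  refine ⟨stageCert (Nat.find hex), (Nat.find_spec hex).mono fun p d h =>
    (knownFrom_stageAnswers.1 h).2, stageAnswers a b r (Nat.find hex), hreach _ le_rfl, ?_⟩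
  rw [certProcedure, length_stageAnswers, if_pos (Nat.find_spec hex)]

theorem mainTheorem2 :
    (∀ (a b r : ℝ) (hr : 0 < r),
      (disc a b r ∩ quadrant = ∅ → discSemigroup a b r hr = ⊥) ∧
      ∀ τ₁ τ₂ : Submodule ℝ Plane, AreExtremalRays a b r τ₁ τ₂ →
        ((discSemigroup a b r hr).FG ↔
          HasRationalPoint (disc a b r ∩ τ₁) ∧ HasRationalPoint (disc a b r ∩ τ₂)) ∧
        ((discSemigroup a b r hr).FG →
          (discSemigroup a b r hr : Set (ℕ × ℕ)) ⊆ integerCone a b r ∧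
          {n | n ∈ integerCone a b r ∧ latticePoint n ∉ τ₁ ∧ latticePoint n ∉ τ₂ ∧
            n ∉ discSemigroup a b r hr}.Finite)) ∧
    ∃ M : Procedure, Computable M ∧
      ∀ (a b r : ℝ) (hr : 0 < r),
        (disc a b r ∩ quadrant = ∅ ∨ ∃ τ₁ τ₂ : Submodule ℝ Plane, AreExtremalRays a b r τ₁ τ₂) →
        (discSemigroup a b r hr).FG →
        ∃ l : List (ℕ × ℕ), M.Outputs a b r l ∧
          IsMinimalGeneratingSystem {n | n ∈ l} (discSemigroup a b r hr) := by
  refine ⟨fun a b r hr => ⟨discSemigroup_eq_bot hr, fun τ₁ τ₂ h => h.main hr⟩, certProcedure,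
    computable_certProcedure, fun a b r hr h hfg => ?_⟩
  obtain ⟨c, hc⟩ := exists_isCert hr h hfg
  obtain ⟨c', hc', hout⟩ := certProcedure_outputs hc
  exact ⟨c'.gens, hout, hc'.isMinimalGeneratingSystem hr⟩
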